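/- An ai-semiring is an algebra $(S,+,\cdot)$ with two binary operations such that $(S,+)$ is a commutative idempotent semigroup, $(S,\cdot)$ is a semigroup, and $\cdot$ distributes over $+$ on both sides. A flat semiring is an ai-semiring whose multiplicative reduct has a zero element $0$ and in which $a+b=0$ for all distinct $a,b$. A variety is a class of algebras with two binary operations that is closed under homomorphic images, subalgebras and direct products; $\mathsf V(K)$ denotes the smallest variety containing $K$. A variety is finitely based if it is the class of all algebras (with two binary operations) satisfying some finite set of identities, and an algebra $A$ is finitely based if $\mathsf V(A)$ is. A limit variety is a variety that is not finitely based but all of whose proper subvarieties are finitely based. Let $\mathbb N_{\max}$ be the max-plus algebra on the nonnegative integers, in the signature $\{+,\vee\}$ without constants; as an ai-semiring, its addition is $a\vee b=\max(a,b)$ and its multiplication is the usual addition of integers. Let $S(a)=\{a,0\}$ and $M(1)=\{1,0\}$ be the two-element flat semirings with $a\cdot a=0$ and $1\cdot 1=1$ respectively, where $0$ is the multiplicative zero. Theorem. (1) There is a limit variety contained in $\mathsf V(\mathbb N_{\max})$. (2) Every flat semiring in $\mathsf V(\mathbb N_{\max})$, and hence every flat semiring in such a limit variety, is finitely based and belongs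 to $\mathsf V(S(a),M(1))$. -/

import Mathlib

universe u

namespace AISemiring

/-- A (nonempty) algebra with two binary operations `+` and `*`. -/
structure Alg : Type (u + 1) where
  carrier : Type u
  [add : Add carrier]
  [mul : Mul carrier]
  [nonempty : Nonempty carrier]

instance : CoeSort Alg.{u} (Type u) := ⟨Alg.carrier⟩

attribute [instance] Alg.add Alg.mul Alg.nonempty

/-- `f` is a homomorphism in the signature `{+, *}`. -/
def IsHom {A B : Alg.{u}} (f : A → B) : Prop :=
  (∀ x y, f (x + y) = f x + f y) ∧ (∀ x y, f (x * y) = f x * f y)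

/-- The direct product of a family of algebras, with componentwise operations. -/
def prod {I : Type u} (A : I → Alg.{u}) : Alg.{u} where
  carrier := ∀ i, A i
  add := ⟨fun x y i => x i + y i⟩
  mul := ⟨fun x y i => x i * y i⟩

/-- A variety: a class of algebras closed under homomorphic images, (isomorphic copies of)
subalgebras and arbitrary direct products. -/
structure IsVariety (V : Set Alg.{u}) : Prop where
  hom_image : ∀ (A B : Alg.{u}) (f : A → B), A ∈ V → IsHom f → Function.Surjective f → B ∈ V
  subalgebra : ∀ (A B : Alg.{u}) (f : A → B), B ∈ V → IsHom f → Function.Injective f → A ∈ V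
  product : ∀ (I : Type u) (A : I → Alg.{u}), (∀ i, A i ∈ V) → prod A ∈ V

/-- The variety generated by a class `K`: the smallest variety containing `K`. -/
def variety (K : Set Alg.{u}) : Set Alg.{u} :=
  {A | ∀ V : Set Alg.{u}, IsVariety V → K ⊆ V → A ∈ V}

/-- Terms in the signature `{+, *}` over countably many variables. -/
inductive Term : Type
  | var : ℕ → Term
  | add : Term → Term → Term
  | mul : Term → Term → Term

/-- The value of a term in an algebra under an assignment of the variables. -/
def Term.eval {A : Alg.{u}} (v : ℕ → A) : Term → A
  | var n => v n
  | add s t => s.eval v + t.eval v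
  | mul s t => s.eval v * t.eval v

/-- The algebra `A` satisfies the identity `e.1 ≈ e.2`. -/
def Satisfies (A : Alg.{u}) (e : Term × Term) : Prop :=
  ∀ v : ℕ → A, e.1.eval v = e.2.eval v

/-- A class of algebras is finitely based if it is defined by finitely many identities. -/
def FinitelyBased (V : Set Alg.{u}) : Prop :=
  ∃ E : Set (Term × Term), E.Finite ∧ V = {A : Alg.{u} | ∀ e ∈ E, Satisfies A e}

/-- A limit variety: a nonfinitely based variety all of whose proper subvarieties are
finitely based. -/
def IsLimitVariety (V : Set Alg.{u}) : Prop :=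
  IsVariety V ∧ ¬ FinitelyBased V ∧ ∀ W : Set Alg.{u}, IsVariety W → W ⊂ V → FinitelyBased W

/-- Additively idempotent semirings. -/
structure IsAISemiring (A : Alg.{u}) : Prop where
  add_assoc : ∀ a b c : A, a + b + c = a + (b + c)
  add_comm : ∀ a b : A, a + b = b + a
  add_idem : ∀ a : A, a + a = a
  mul_assoc : ∀ a b c : A, a * b * c = a * (b * c)
  left_distrib : ∀ a b c : A, a * (b + c) = a * b + a * c
  right_distrib : ∀ a b c : A, (a + b) * c = a * c + b * c

/-- Flat semirings: ai-semirings with a multiplicative zero `z` such that `a + b = z` for all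
distinct `a` and `b`. -/
def IsFlatSemiring (A : Alg.{u}) : Prop :=
  IsAISemiring A ∧ ∃ z : A, (∀ a : A, z * a = z ∧ a * z = z) ∧ ∀ a b : A, a ≠ b → a + b = z

/-- The max-plus algebra on the nonnegative integers: the semiring addition is the maximum and
the semiring multiplication is the addition of integers. -/
def maxPlus : Alg.{u} where
  carrier := ULift.{u} ℕ
  add := ⟨fun a b => ⟨max a.down b.down⟩⟩
  mul := ⟨fun a b => ⟨a.down + b.down⟩⟩

open Classical in
/-- For a set `F` of words, the algebra on `F` together with a new element `0 = none`, where
`u * v` is the concatenation `uv` if this lies in `F` and `0` otherwise, and `u + v = 0` for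
`u ≠ v`, `u + u = u`. -/
noncomputable def flatWords {X : Type u} (F : Set (List X)) : Alg.{u} where
  carrier := Option {w : List X // w ∈ F}
  add := ⟨fun a b => if a = b then a else none⟩
  mul := ⟨fun a b =>
    match a, b with
    | some p, some q => if h : p.1 ++ q.1 ∈ F then some ⟨p.1 ++ q.1, h⟩ else none
    | _, _ => none⟩

/-- `S(W)`: the nonempty subwords of words in `W`, together with `0`. -/
noncomputable def S {X : Type u} (W : Set (List X)) : Alg.{u} :=
  flatWords {w | w ≠ [] ∧ ∃ w' ∈ W, w <:+: w'}

/-- `M(W)`: the possibly empty subwords of words in `W`, together with `0`. -/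
noncomputable def M {X : Type u} (W : Set (List X)) : Alg.{u} :=
  flatWords {w | ∃ w' ∈ W, w <:+: w'}

/-- `S(a)`, for a single letter `a`. -/
noncomputable def Sa : Alg.{u} := S {[PUnit.unit.{u + 1}]}

/-- `M(1)`, where `1` is the empty word. -/
noncomputable def M1 : Alg.{u} := M {([] : List PUnit.{u + 1})}

end AISemiring

/-! Part (1). By Zorn's lemma every nonfinitely based variety contains a limit variety
(`exists_limitVariety_subset`). The point is that an identity of the intersection of a chain of
varieties already holds in some member: by Birkhoff's theorem the free algebra of the union of the
theories lies in every member. Hence a finite basis of the intersection would be a basis of one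
member.

The max-plus algebra is not finitely based because of the algebras `gap p`. For `p ≥ 2` the identity
`(x + y) ^ p ≈ x ^ p + y ^ p` of max-plus fails in `gap p`, yet each single identity of max-plus
fails in `gap p` for only finitely many primes `p`; so any finite set of them holds in some `gap p`
with `p` prime. To see the finiteness, write a term as a maximum of linear forms, one per
commutative monomial. A failure in `gap p` leaves a triple `(S, m', X)`: the monomials `S` of
maximal weight `p` on one side, each inside or disjoint from a set `X` of variables, and a monomial
`m'` of weight `p` on the other side that meets both `X` and its complement. Perturbing the
assignment shows that a linear functional vanishing on `S` vanishes on `m'`. If primes `p₁`, `p₂`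
give the same triple, with degrees restricted to `X` denoted `e₁`, `e₂`, then `p₁ e₂ - p₂ e₁`
vanishes on `S`. Hence `p₁ e₂(m') = p₂ e₁(m')` with `0 < e₁(m') < p₁`, which forces `p₁ = p₂`. For a
given identity there are finitely many triples.

Part (2). The law `x + xy ≈ xy` makes every product `ab` in a flat member equal to `a` or `0`, and
commutativity then makes products of distinct elements `0`. In such a semiring squaring is a closure
operator on the semilattice, and the maps `a ↦ (a ≤ c)` embed it in a product of two-element flat
semirings. Which of these two-element semirings lie in the generated variety decides its finite
basis. -/

namespace AISemiring

/-! ### Identities and varieties -/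

/-- The class of algebras satisfying all identities in `E`. -/
def models (E : Set (Term × Term)) : Set Alg.{u} := {A | ∀ e ∈ E, Satisfies A e}

theorem Term.eval_hom {A B : Alg.{u}} {f : A → B} (hf : IsHom f) (v : ℕ → A) (t : Term) :
    t.eval (fun n => f (v n)) = f (t.eval v) := by
  induction t with
  | var n => rfl
  | add s t hs ht => simp only [Term.eval, hs, ht, hf.1]
  | mul s t hs ht => simp only [Term.eval, hs, ht, hf.2]

theorem proj_isHom {I : Type u} (A : I → Alg.{u}) (i : I) :
    IsHom (A := prod A) (B := A i) (fun x => x i) :=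
  ⟨fun _ _ => rfl, fun _ _ => rfl⟩

theorem isVariety_models (E : Set (Term × Term)) : IsVariety (models.{u} E) where
  hom_image A B f hA hf hs e he v := by
    choose g hg using hs
    have h := hA e he (fun n => g (v n))
    have hv : v = fun n => f (g (v n)) := funext fun n => (hg (v n)).symm
    rw [hv, Term.eval_hom hf, Term.eval_hom hf, h]
  subalgebra A B f hB hf hi e he v := by
    apply hi
    rw [← Term.eval_hom hf, ← Term.eval_hom hf]
    exact hB e he _
  product I A hA e he v := by
    funext i
    have h := hA i e he (fun n => v n i)
    exact ((Term.eval_hom (proj_isHom A i) v e.1).symm.trans h).trans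
      (Term.eval_hom (proj_isHom A i) v e.2)

theorem isVariety_variety (K : Set Alg.{u}) : IsVariety (variety K) where
  hom_image A B f hA hf hs V hV hK := hV.hom_image A B f (hA V hV hK) hf hs
  subalgebra A B f hB hf hi V hV hK := hV.subalgebra A B f (hB V hV hK) hf hi
  product I A hA V hV hK := hV.product I A fun i => hA i V hV hK

theorem subset_variety (K : Set Alg.{u}) : K ⊆ variety K := fun _ hA _ _ hK => hK hA

theorem variety_subset {K V : Set Alg.{u}} (hV : IsVariety V) (hK : K ⊆ V) : variety K ⊆ V :=
  fun _ hA => hA V hV hK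

theorem isVariety_sInter {c : Set (Set Alg.{u})} (hc : ∀ W ∈ c, IsVariety W) :
    IsVariety (⋂₀ c) where
  hom_image A B f hA hf hs W hW := (hc W hW).hom_image A B f (hA W hW) hf hs
  subalgebra A B f hB hf hi W hW := (hc W hW).subalgebra A B f (hB W hW) hf hi
  product I A hA W hW := (hc W hW).product I A fun i => hA i W hW

theorem satisfies_of_mem_variety {A B : Alg.{u}} {e : Term × Term} (he : Satisfies A e)
    (hB : B ∈ variety {A}) : Satisfies B e :=
  variety_subset (isVariety_models {e}) (by rintro _ rfl e' rfl; exact he) hB e rfl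

/-! ### Birkhoff's theorem -/

/-- Terms with variables in an arbitrary type. -/
inductive FTerm (X : Type u) : Type u
  | var : X → FTerm X
  | add : FTerm X → FTerm X → FTerm X
  | mul : FTerm X → FTerm X → FTerm X

namespace FTerm

/-- The value of a term. -/
def eval {X : Type u} {A : Alg.{u}} (v : X → A) : FTerm X → A
  | var x => v x
  | add s t => s.eval v + t.eval v
  | mul s t => s.eval v * t.eval v

/-- Renaming the variables by natural numbers. -/
def rename {X : Type u} (r : X → ℕ) : FTerm X → Term
  | var x => .var (r x)
  | add s t => .add (s.rename r) (t.rename r)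
  | mul s t => .mul (s.rename r) (t.rename r)

/-- The variables of a term. -/
def vars {X : Type u} : FTerm X → Set X
  | var x => {x}
  | add s t => s.vars ∪ t.vars
  | mul s t => s.vars ∪ t.vars

theorem vars_finite {X : Type u} (t : FTerm X) : t.vars.Finite := by
  induction t with
  | var x => exact Set.finite_singleton x
  | add s t hs ht => exact hs.union ht
  | mul s t hs ht => exact hs.union ht

theorem eval_rename {X : Type u} {A : Alg.{u}} (r : X → ℕ) (v : ℕ → A) (t : FTerm X) :
    (t.rename r).eval v = t.eval (fun x => v (r x)) := by
  induction t with
  | var x => rfl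
  | add s t hs ht => simp only [rename, eval, Term.eval, hs, ht]
  | mul s t hs ht => simp only [rename, eval, Term.eval, hs, ht]

theorem eval_congr {X : Type u} {A : Alg.{u}} {v w : X → A} (t : FTerm X)
    (h : ∀ x ∈ t.vars, v x = w x) : t.eval v = t.eval w := by
  induction t with
  | var x => exact h x rfl
  | add s t hs ht =>
    simp only [eval, hs fun x hx => h x (Or.inl hx), ht fun x hx => h x (Or.inr hx)]
  | mul s t hs ht =>
    simp only [eval, hs fun x hx => h x (Or.inl hx), ht fun x hx => h x (Or.inr hx)]

theorem eval_hom {X : Type u} {A B : Alg.{u}} {f : A → B} (hf : IsHom f) (v : X → A)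
    (t : FTerm X) : t.eval (fun x => f (v x)) = f (t.eval v) := by
  induction t with
  | var n => rfl
  | add s t hs ht => simp only [eval, hs, ht, hf.1]
  | mul s t hs ht => simp only [eval, hs, ht, hf.2]

end FTerm

/-- The subalgebra generated by the range of `v`. -/
def generated {X : Type u} [Nonempty X] {P : Alg.{u}} (v : X → P) : Alg.{u} where
  carrier := {a : P // ∃ t : FTerm X, t.eval v = a}
  add := ⟨fun a b => ⟨a.1 + b.1, by
    obtain ⟨s, hs⟩ := a.2
    obtain ⟨t, ht⟩ := b.2
    exact ⟨.add s t, by simp only [FTerm.eval, hs, ht]⟩⟩⟩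
  mul := ⟨fun a b => ⟨a.1 * b.1, by
    obtain ⟨s, hs⟩ := a.2
    obtain ⟨t, ht⟩ := b.2
    exact ⟨.mul s t, by simp only [FTerm.eval, hs, ht]⟩⟩⟩
  nonempty := ⟨⟨_, .var (Classical.arbitrary X), rfl⟩⟩

/-- Birkhoff's theorem: an algebra satisfying all identities of a variety belongs to it. -/
theorem IsVariety.mem_of_satisfies {V : Set Alg.{u}} (hV : IsVariety V) {A : Alg.{u}}
    (hA : ∀ e : Term × Term, (∀ B ∈ V, Satisfies B e) → Satisfies A e) : A ∈ V := by
  classical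
  -- One coordinate for each pair of terms over `A` that some member of `V` separates, so the
  -- product is indexed by a set and `g` generates a relatively free algebra on `A`.
  let I : Type u := {e : FTerm A × FTerm A //
    ∃ B : Alg.{u}, ∃ v : A → B, B ∈ V ∧ e.1.eval v ≠ e.2.eval v}
  choose B v hB hv using fun i : I => i.2
  let P : Alg.{u} := prod B
  let g : A → P := fun a i => v i a
  have key : ∀ s t : FTerm A, s.eval g = t.eval g →
      s.eval (A := A) (fun a => a) = t.eval (fun a => a) := by
    intro s t hst
    have hall : ∀ C ∈ V, ∀ w : A → C, s.eval w = t.eval w := by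
      intro C hC w
      by_contra hne
      let i : I := ⟨(s, t), C, w, hC, hne⟩
      apply hv i
      have h := congrFun hst i
      exact ((FTerm.eval_hom (proj_isHom B i) g s).trans h).trans
        (FTerm.eval_hom (proj_isHom B i) g t).symm
    -- Only finitely many variables occur, so they can be renamed injectively by natural numbers,
    -- and the inverse renaming recovers the identical assignment.
    obtain ⟨r, hr⟩ := Set.countable_iff_exists_injOn.1
      ((s.vars_finite.union t.vars_finite).countable)
    have hid := hA (s.rename r, t.rename r) (fun C hC w => by
      simp only [FTerm.eval_rename]
      exact hall C hC _) (Function.invFunOn r (s.vars ∪ t.vars))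
    simp only [FTerm.eval_rename] at hid
    rw [s.eval_congr (w := fun a => a), t.eval_congr (w := fun a => a)] at hid
    · exact hid
    · exact fun x hx => hr.leftInvOn_invFunOn (Or.inr hx)
    · exact fun x hx => hr.leftInvOn_invFunOn (Or.inl hx)
  have hP : P ∈ V := hV.product I B hB
  have hG : generated g ∈ V := hV.subalgebra (generated g) P (fun a => a.1) hP
    ⟨fun _ _ => rfl, fun _ _ => rfl⟩ Subtype.val_injective
  let f : generated g → A := fun a => a.2.choose.eval (fun a => a)
  have hf : ∀ (t : FTerm A) (a : generated g), t.eval g = a.1 → f a = t.eval (fun a => a) :=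
    fun t a h => key _ _ (a.2.choose_spec.trans h.symm)
  refine hV.hom_image (generated g) A f hG ⟨fun a b => ?_, fun a b => ?_⟩ fun a => ?_
  · obtain ⟨s, hs⟩ := a.2
    obtain ⟨t, ht⟩ := b.2
    rw [hf s a hs, hf t b ht]
    refine hf (.add s t) (a + b) ?_
    simp only [FTerm.eval, hs, ht]
    rfl
  · obtain ⟨s, hs⟩ := a.2
    obtain ⟨t, ht⟩ := b.2
    rw [hf s a hs, hf t b ht]
    refine hf (.mul s t) (a * b) ?_
    simp only [FTerm.eval, hs, ht]
    rfl
  · exact ⟨⟨g a, .var a, rfl⟩, hf (.var a) _ rfl⟩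

/-! ### Existence of limit subvarieties -/

namespace Term

/-- Simultaneous substitution. -/
def subst (r : ℕ → Term) : Term → Term
  | var n => r n
  | add s t => .add (s.subst r) (t.subst r)
  | mul s t => .mul (s.subst r) (t.subst r)

theorem eval_subst {A : Alg.{u}} (r : ℕ → Term) (v : ℕ → A) (t : Term) :
    (t.subst r).eval v = t.eval (fun n => (r n).eval v) := by
  induction t with
  | var n => rfl
  | add s t hs ht => simp only [subst, eval, hs, ht]
  | mul s t hs ht => simp only [subst, eval, hs, ht]

end Term

theorem exists_mem_subset_of_isChain {α : Type*} {c : Set (Set α)} (hc : IsChain (· ⊆ ·) c)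
    {W W' : Set α} (hW : W ∈ c) (hW' : W' ∈ c) : ∃ U ∈ c, U ⊆ W ∧ U ⊆ W' := by
  rcases hc.total hW hW' with h | h
  · exact ⟨W, hW, subset_rfl, h⟩
  · exact ⟨W', hW', h, subset_rfl⟩

/-- The union of the equational theories of a chain of classes, as an equivalence relation. -/
def chainSetoid {c : Set (Set Alg.{u})} (hc : IsChain (· ⊆ ·) c) (hne : c.Nonempty) :
    Setoid Term where
  r s t := ∃ W ∈ c, ∀ A ∈ W, Satisfies A (s, t)
  iseqv := by
    refine ⟨fun s => hne.imp fun W hW => ⟨hW, fun A _ v => rfl⟩, ?_, ?_⟩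
    · rintro s t ⟨W, hW, h⟩
      exact ⟨W, hW, fun A hA v => (h A hA v).symm⟩
    · rintro s t r ⟨W, hW, h⟩ ⟨W', hW', h'⟩
      obtain ⟨W'', hW'', h1, h2⟩ := exists_mem_subset_of_isChain hc hW hW'
      exact ⟨W'', hW'', fun A hA v => (h A (h1 hA) v).trans (h' A (h2 hA) v)⟩

/-- The relatively free algebra on countably many generators of the union of the equational
theories of a chain of classes. -/
def chainFree {c : Set (Set Alg.{u})} (hc : IsChain (· ⊆ ·) c) (hne : c.Nonempty) :
    Alg.{u} where
  carrier := ULift.{u} (Quotient (chainSetoid hc hne))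
  add := ⟨fun a b => ⟨Quotient.map₂ Term.add (by
    rintro s s' ⟨W, hW, h⟩ t t' ⟨W', hW', h'⟩
    obtain ⟨W'', hW'', h1, h2⟩ := exists_mem_subset_of_isChain hc hW hW'
    exact ⟨W'', hW'', fun A hA v => congrArg₂ (· + ·) (h A (h1 hA) v) (h' A (h2 hA) v)⟩)
    a.down b.down⟩⟩
  mul := ⟨fun a b => ⟨Quotient.map₂ Term.mul (by
    rintro s s' ⟨W, hW, h⟩ t t' ⟨W', hW', h'⟩
    obtain ⟨W'', hW'', h1, h2⟩ := exists_mem_subset_of_isChain hc hW hW'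
    exact ⟨W'', hW'', fun A hA v => congrArg₂ (· * ·) (h A (h1 hA) v) (h' A (h2 hA) v)⟩)
    a.down b.down⟩⟩
  nonempty := ⟨⟨Quotient.mk _ (.var 0)⟩⟩

theorem eval_chainFree {c : Set (Set Alg.{u})} (hc : IsChain (· ⊆ ·) c) (hne : c.Nonempty)
    (r : ℕ → Term) (t : Term) :
    t.eval (A := chainFree hc hne) (fun n => ⟨Quotient.mk _ (r n)⟩) =
      ⟨Quotient.mk _ (t.subst r)⟩ := by
  induction t with
  | var n => rfl
  | add s t hs ht => simp only [Term.eval, hs, ht]; rfl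
  | mul s t hs ht => simp only [Term.eval, hs, ht]; rfl

/-- An assignment in the free algebra is a substitution of terms, and identities of a class are
stable under substitution. -/
theorem satisfies_chainFree {c : Set (Set Alg.{u})} (hc : IsChain (· ⊆ ·) c)
    (hne : c.Nonempty) {W : Set Alg.{u}} (hW : W ∈ c) {e : Term × Term}
    (he : ∀ A ∈ W, Satisfies A e) : Satisfies (chainFree hc hne) e := by
  intro v
  choose r hr using fun n => Quotient.exists_rep (v n).down
  have hv : v = fun n => ⟨Quotient.mk _ (r n)⟩ := funext fun n => ULift.ext _ _ (hr n).symm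
  rw [hv, eval_chainFree, eval_chainFree]
  refine ULift.ext _ _ (Quotient.sound ⟨W, hW, fun A hA w => ?_⟩)
  simp only [Term.eval_subst]
  exact he A hA _

/-- The free algebra of the union of the theories satisfies the theory of each member, so by
Birkhoff it lies in the intersection. Evaluating the identity at its generators puts it in the
union. -/
theorem exists_mem_satisfies_of_sInter {c : Set (Set Alg.{u})} (hc : IsChain (· ⊆ ·) c)
    (hne : c.Nonempty) (hvar : ∀ W ∈ c, IsVariety W) {e : Term × Term}
    (he : ∀ A ∈ ⋂₀ c, Satisfies A e) : ∃ W ∈ c, ∀ A ∈ W, Satisfies A e := by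
  have hF : chainFree hc hne ∈ ⋂₀ c := fun W hW =>
    (hvar W hW).mem_of_satisfies fun e' he' => satisfies_chainFree hc hne hW he'
  have h := he _ hF (fun n => ⟨Quotient.mk _ (.var n)⟩)
  rw [eval_chainFree, eval_chainFree] at h
  obtain ⟨W, hW, hWe⟩ := Quotient.exact (congrArg ULift.down h)
  refine ⟨W, hW, fun A hA v => ?_⟩
  have h' := hWe A hA v
  simp only [Term.eval_subst] at h'
  exact h'

theorem exists_mem_subset_models {c : Set (Set Alg.{u})} (hc : IsChain (· ⊆ ·) c)
    (hne : c.Nonempty) (hvar : ∀ W ∈ c, IsVariety W) {E : Set (Term × Term)} (hE : E.Finite)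
    (hsub : ⋂₀ c ⊆ models E) : ∃ W ∈ c, W ⊆ models E := by
  induction E, hE using Set.Finite.induction_on with
  | empty => exact hne.imp fun W hW => ⟨hW, fun A _ e he => he.elim⟩
  | @insert e E _ _ ih =>
    obtain ⟨W, hW, h⟩ := ih fun A hA e' he' => hsub hA e' (Or.inr he')
    obtain ⟨W', hW', h'⟩ := exists_mem_satisfies_of_sInter hc hne hvar
      fun A hA => hsub hA e (Or.inl rfl)
    obtain ⟨W'', hW'', h1, h2⟩ := exists_mem_subset_of_isChain hc hW hW'
    refine ⟨W'', hW'', fun A hA e' he' => ?_⟩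
    rcases he' with rfl | he'
    · exact h' A (h2 hA)
    · exact h (h1 hA) e' he'

/-- Every nonfinitely based variety contains a limit variety. -/
theorem exists_limitVariety_subset {V : Set Alg.{u}} (hV : IsVariety V)
    (hnfb : ¬ FinitelyBased V) : ∃ L : Set Alg.{u}, IsLimitVariety L ∧ L ⊆ V := by
  obtain ⟨L, hLV, hL⟩ := zorn_superset_nonempty
    {W : Set Alg.{u} | IsVariety W ∧ ¬ FinitelyBased W} (fun c hcS hc hne => by
      refine ⟨⋂₀ c, ⟨isVariety_sInter fun W hW => (hcS hW).1, ?_⟩,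
        fun W hW => Set.sInter_subset_of_mem hW⟩
      -- A finite basis of the intersection holds in one member `W`, which then equals the
      -- intersection and is itself finitely based.
      rintro ⟨E, hE, hcE⟩
      obtain ⟨W, hW, hWE⟩ := exists_mem_subset_models hc hne (fun W hW => (hcS hW).1) hE
        (fun A hA => by rw [hcE] at hA; exact hA)
      refine (hcS hW).2 ⟨E, hE, hWE.antisymm ?_⟩
      refine Eq.trans_subset hcE.symm ?_
      exact Set.sInter_subset_of_mem hW) V ⟨hV, hnfb⟩
  refine ⟨L, ⟨hL.prop.1, hL.prop.2, fun W hW hWL => ?_⟩, hLV⟩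
  by_contra hW'
  exact hWL.2 (hL.le_of_le ⟨hW, hW'⟩ hWL.1)


/-! ### Terms as sets of commutative monomials -/

/-- The commutative monomials of a term. -/
def Term.mons : Term → Finset (Multiset ℕ)
  | var n => {{n}}
  | add s t => s.mons ∪ t.mons
  | mul s t => Finset.image₂ (· + ·) s.mons t.mons

/-- The weight of a monomial under a weighting of the variables. -/
def weight {R : Type*} [AddCommMonoid R] (d : ℕ → R) (m : Multiset ℕ) : R := (m.map d).sum

section weight

variable {R : Type*} [AddCommMonoid R] (d : ℕ → R)

@[simp] theorem weight_singleton (n : ℕ) : weight d {n} = d n := by simp [weight]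

@[simp] theorem weight_add (m m' : Multiset ℕ) : weight d (m + m') = weight d m + weight d m' := by
  simp [weight]

end weight

theorem Term.mem_mons_mul {s t : Term} {m : Multiset ℕ} :
    m ∈ (mul s t).mons ↔ ∃ m₁ ∈ s.mons, ∃ m₂ ∈ t.mons, m₁ + m₂ = m := by
  simp [mons, Finset.mem_image₂]

theorem Term.mem_mons_add {s t : Term} {m : Multiset ℕ} :
    m ∈ (add s t).mons ↔ m ∈ s.mons ∨ m ∈ t.mons := by
  simp [mons]

theorem Term.mons_nonempty (t : Term) : t.mons.Nonempty := by
  induction t with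
  | var n => exact Finset.singleton_nonempty _
  | add s t hs ht => exact hs.mono Finset.subset_union_left
  | mul s t hs ht => exact hs.image₂ ht

theorem Term.ne_zero_of_mem_mons (t : Term) : ∀ m ∈ t.mons, m ≠ 0 := by
  induction t with
  | var n => simp [mons]
  | add s t hs ht =>
    intro m hm
    rcases mem_mons_add.1 hm with h | h
    exacts [hs m h, ht m h]
  | mul s t hs ht =>
    intro m hm
    obtain ⟨m₁, h₁, m₂, h₂, rfl⟩ := mem_mons_mul.1 hm
    simp [hs m₁ h₁]

/-- The value of a term in the max-plus algebra. -/
def Term.maxPlusVal (v : ℕ → ℕ) : Term → ℕ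
  | var n => v n
  | add s t => max (s.maxPlusVal v) (t.maxPlusVal v)
  | mul s t => s.maxPlusVal v + t.maxPlusVal v

theorem Term.eval_maxPlus (v : ℕ → ℕ) (t : Term) :
    t.eval (A := maxPlus.{u}) (fun n => ⟨v n⟩) = ⟨t.maxPlusVal v⟩ := by
  induction t with
  | var n => rfl
  | add s t hs ht => simp only [eval, hs, ht]; rfl
  | mul s t hs ht => simp only [eval, hs, ht]; rfl

theorem satisfies_maxPlus_iff {e : Term × Term} :
    Satisfies maxPlus.{u} e ↔ ∀ v, e.1.maxPlusVal v = e.2.maxPlusVal v := by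
  constructor
  · intro h v
    have := h (fun n => ⟨v n⟩)
    rw [Term.eval_maxPlus, Term.eval_maxPlus] at this
    exact congrArg ULift.down this
  · intro h v
    have := h fun n => (v n).down
    exact (Term.eval_maxPlus _ e.1).trans ((congrArg ULift.up this).trans
      (Term.eval_maxPlus _ e.2).symm)

theorem Term.weight_le_maxPlusVal (v : ℕ → ℕ) (t : Term) :
    ∀ m ∈ t.mons, weight v m ≤ t.maxPlusVal v := by
  induction t with
  | var n => simp [mons, maxPlusVal]
  | add s t hs ht =>
    intro m hm
    rcases mem_mons_add.1 hm with h | h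
    exacts [(hs m h).trans (le_max_left _ _), (ht m h).trans (le_max_right _ _)]
  | mul s t hs ht =>
    intro m hm
    obtain ⟨m₁, h₁, m₂, h₂, rfl⟩ := mem_mons_mul.1 hm
    rw [weight_add]
    exact Nat.add_le_add (hs m₁ h₁) (ht m₂ h₂)

theorem Term.exists_weight_eq_maxPlusVal (v : ℕ → ℕ) (t : Term) :
    ∃ m ∈ t.mons, weight v m = t.maxPlusVal v := by
  induction t with
  | var n => simp [mons, maxPlusVal]
  | add s t hs ht =>
    obtain ⟨m₁, h₁, e₁⟩ := hs
    obtain ⟨m₂, h₂, e₂⟩ := ht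
    rcases le_total (s.maxPlusVal v) (t.maxPlusVal v) with h | h
    · exact ⟨m₂, mem_mons_add.2 (Or.inr h₂), by rw [e₂, maxPlusVal, max_eq_right h]⟩
    · exact ⟨m₁, mem_mons_add.2 (Or.inl h₁), by rw [e₁, maxPlusVal, max_eq_left h]⟩
  | mul s t hs ht =>
    obtain ⟨m₁, h₁, e₁⟩ := hs
    obtain ⟨m₂, h₂, e₂⟩ := ht
    exact ⟨m₁ + m₂, mem_mons_mul.2 ⟨m₁, h₁, m₂, h₂, rfl⟩, by rw [weight_add, e₁, e₂, maxPlusVal]⟩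

/-! ### Perturbation of assignments in the max-plus algebra. -/

theorem le_weight_of_mem {d : ℕ → ℕ} {m : Multiset ℕ} {z : ℕ} (h : z ∈ m) : d z ≤ weight d m :=
  Multiset.single_le_sum (fun _ _ => Nat.zero_le _) _ (Multiset.mem_map_of_mem d h)

theorem abs_weight_le {ε : ℕ → ℤ} {K : ℕ} (hε : ∀ z, |ε z| ≤ K) (m : Multiset ℕ) :
    |weight ε m| ≤ K * m.card := by
  induction m using Multiset.induction_on with
  | empty => simp [weight]
  | cons z m ih =>
    rw [← Multiset.singleton_add, weight_add, weight_singleton, Multiset.card_add,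
      Multiset.card_singleton]
    push_cast
    calc |ε z + weight ε m| ≤ |ε z| + |weight ε m| := abs_add_le _ _
      _ ≤ K + K * m.card := add_le_add (hε z) ih
      _ = K * (1 + m.card) := by ring

theorem weight_perturb {d v : ℕ → ℕ} {ε : ℕ → ℤ} {N : ℕ} (hv : ∀ z, (v z : ℤ) = N * d z + ε z)
    (m : Multiset ℕ) : ((weight v m : ℕ) : ℤ) = N * (weight d m : ℕ) + weight ε m := by
  induction m using Multiset.induction_on with
  | empty => simp [weight]
  | cons z m ih =>
    rw [← Multiset.singleton_add, weight_add, weight_add, weight_add, weight_singleton,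
      weight_singleton, weight_singleton]
    push_cast
    rw [ih, hv]
    ring

/-- Perturbation of assignments: a monomial of maximal weight on one side of an identity of the
max-plus algebra is dominated, in every direction, by one on the other side. -/
theorem exists_top_of_perturb {s t : Term} (hst : ∀ v, s.maxPlusVal v = t.maxPlusVal v)
    {d : ℕ → ℕ} (hd : ∀ z, 1 ≤ d z) {D : ℕ} (hs : ∀ m ∈ s.mons, weight d m ≤ D)
    {m' : Multiset ℕ} (hm' : m' ∈ t.mons) (hD : weight d m' = D) {ε : ℕ → ℤ} {K : ℕ}
    (hε : ∀ z, |ε z| ≤ K) :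
    ∃ m ∈ s.mons, weight d m = D ∧ weight ε m' ≤ weight ε m := by
  set C := s.mons.sup Multiset.card with hC
  -- `N ≥ K` keeps the assignment `N * d + ε` nonnegative, as `d ≥ 1`. `N > K * (C + m'.card)` makes
  -- a loss of one unit of `d`-weight outweigh any gain from `ε`.
  set N := K * (C + m'.card) + K + 1 with hN
  let v : ℕ → ℕ := fun z => (N * d z + ε z).toNat
  have hv : ∀ z, (v z : ℤ) = N * d z + ε z := by
    intro z
    refine Int.toNat_of_nonneg ?_
    have h1 := (abs_le.1 (hε z)).1
    have h2 : (K : ℤ) ≤ N := by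
      rw [hN]; push_cast; nlinarith [Int.natCast_nonneg (K * (C + m'.card))]
    have h3 : (N : ℤ) ≤ N * d z := by
      have := hd z
      exact_mod_cast Nat.le_mul_of_pos_right N this
    linarith
  obtain ⟨m, hm, e⟩ := s.exists_weight_eq_maxPlusVal v
  have hle : weight v m' ≤ weight v m := by
    rw [e, hst v]
    exact t.weight_le_maxPlusVal v m' hm'
  have hle' : (N : ℤ) * (weight d m' : ℕ) + weight ε m' ≤ N * (weight d m : ℕ) + weight ε m := by
    rw [← weight_perturb hv, ← weight_perturb hv]
    exact_mod_cast hle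
  have hCm : m.card ≤ C := Finset.le_sup (f := Multiset.card) hm
  have h1 := (abs_le.1 (abs_weight_le hε m)).2
  have h2 := (abs_le.1 (abs_weight_le hε m')).1
  have htop : weight d m = D := by
    by_contra hne
    have hlt : weight d m + 1 ≤ D := lt_of_le_of_ne (hs m hm) hne
    have h3 : (N : ℤ) * ((weight d m : ℕ) + 1) ≤ N * D := by exact_mod_cast Nat.mul_le_mul_left N hlt
    have h4 : (K : ℤ) * m.card ≤ K * C := by exact_mod_cast Nat.mul_le_mul_left K hCm
    have h5 : (N : ℤ) = K * (C + m'.card) + K + 1 := by rw [hN]; push_cast; ring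
    rw [hD] at hle'
    have h6 : (0 : ℤ) ≤ K := Int.natCast_nonneg K
    nlinarith
  refine ⟨m, hm, htop, ?_⟩
  rw [hD, htop] at hle'
  linarith

theorem weight_indicator_pos_iff (P : ℕ → Prop) [DecidablePred P] (m : Multiset ℕ) :
    0 < weight (fun z => if P z then (1 : ℤ) else 0) m ↔ ∃ z ∈ m, P z := by
  have : weight (fun z => if P z then (1 : ℤ) else 0) m = (m.countP P : ℤ) := by
    induction m using Multiset.induction_on with
    | empty => simp [weight]
    | cons z m ih =>
      rw [Multiset.countP_cons, ← Multiset.singleton_add, weight_add, weight_singleton, ih]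
      by_cases h : P z <;> simp [h, add_comm]
  rw [this]
  exact_mod_cast Multiset.countP_pos

/-- A monomial of maximal weight containing a variable with property `P` is matched on the other
side of an identity of the max-plus algebra. -/
theorem exists_top_mem {s t : Term} (hst : ∀ v, s.maxPlusVal v = t.maxPlusVal v)
    {d : ℕ → ℕ} (hd : ∀ z, 1 ≤ d z) {D : ℕ} (hs : ∀ m ∈ s.mons, weight d m ≤ D)
    {m' : Multiset ℕ} (hm' : m' ∈ t.mons) (hD : weight d m' = D) (P : ℕ → Prop)
    (hP : ∃ z ∈ m', P z) : ∃ m ∈ s.mons, weight d m = D ∧ ∃ z ∈ m, P z := by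
  classical
  obtain ⟨m, hm, hmD, h⟩ := exists_top_of_perturb hst hd hs hm' hD
    (ε := fun z => if P z then 1 else 0) (K := 1) (fun z => by split_ifs <;> simp)
  exact ⟨m, hm, hmD, (weight_indicator_pos_iff P m).1
    (((weight_indicator_pos_iff P m').2 hP).trans_le h)⟩

/-- Under the assignment that is `1` at `z` and `0` elsewhere, the value of a side is positive only
if `z` occurs in it. -/
theorem exists_mem_of_mem {s t : Term} (hst : ∀ v, s.maxPlusVal v = t.maxPlusVal v)
    {m' : Multiset ℕ} (hm' : m' ∈ t.mons) {z : ℕ} (hz : z ∈ m') : ∃ m ∈ s.mons, z ∈ m := by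
  obtain ⟨m, hm, e⟩ := s.exists_weight_eq_maxPlusVal (fun w => if w = z then 1 else 0)
  refine ⟨m, hm, ?_⟩
  by_contra hzm
  have h0 : weight (fun w => if w = z then 1 else 0) m = 0 := by
    refine Multiset.sum_eq_zero fun x hx => ?_
    obtain ⟨w, hw, rfl⟩ := Multiset.mem_map.1 hx
    exact if_neg fun h : w = z => hzm (h ▸ hw)
  have h1 := t.weight_le_maxPlusVal (fun w => if w = z then 1 else 0) m' hm'
  have h2 := le_weight_of_mem (d := fun w => if w = z then 1 else 0) hz
  rw [← hst, ← e, h0] at h1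
  simp only [if_true] at h2
  omega

/-! ### The algebras `gap p` -/

/-- Types of elements of `gap p`. -/
inductive Ty : Type
  | x | y | m
  deriving DecidableEq

namespace Ty

/-- The join of two types; `x` and `y` join to `m`. -/
def join (a b : Ty) : Ty := if a = b then a else m

theorem join_ne_y (a b : Ty) : join a b ≠ y ↔ a ≠ y ∨ b ≠ y := by
  cases a <;> cases b <;> simp [join]

theorem join_ne_x (a b : Ty) : join a b ≠ x ↔ a ≠ x ∨ b ≠ x := by
  cases a <;> cases b <;> simp [join]

theorem eq_m {a : Ty} (h : a ≠ x) (h' : a ≠ y) : a = m := by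
  cases a <;> simp_all

theorem eq_of_iff {a b : Ty} (h : a ≠ x ↔ b ≠ x) (h' : a ≠ y ↔ b ≠ y) : a = b := by
  cases a <;> cases b <;> simp_all

end Ty

/-- Addition of `gap p`: lexicographic maximum, with the join of the types in equal degree. -/
def gapAdd {p : ℕ} : Option (Fin p × Ty) → Option (Fin p × Ty) → Option (Fin p × Ty)
  | some (i, S), some (j, T) =>
    if i < j then some (j, T) else if j < i then some (i, S) else some (i, S.join T)
  | _, _ => none

/-- Multiplication of `gap p`: degrees add and types are joined; products of degree greater than
`p`, and products of degree `p` and mixed type `m`, are `none`. -/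
def gapMul {p : ℕ} : Option (Fin p × Ty) → Option (Fin p × Ty) → Option (Fin p × Ty)
  | some (i, S), some (j, T) =>
    if h : i.1 + j.1 + 1 < p ∧ ¬ (i.1 + j.1 + 2 = p ∧ S.join T = Ty.m) then
      some (⟨i.1 + j.1 + 1, h.1⟩, S.join T) else none
  | _, _ => none

/-- The elements are the pairs of a degree in `{1, …, p}` (stored in `Fin p`, shifted by one) and
a type, together with a top element `none`. -/
def gap (p : ℕ) : Alg.{u} where
  carrier := ULift.{u} (Option (Fin p × Ty))
  add := ⟨fun a b => ⟨gapAdd a.down b.down⟩⟩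
  mul := ⟨fun a b => ⟨gapMul a.down b.down⟩⟩
  nonempty := ⟨⟨none⟩⟩

namespace gap

variable {p : ℕ}

/-- The degree. -/
def deg (a : gap.{u} p) : ℕ := a.down.elim 1 fun q => q.1.1 + 1

/-- The type. -/
def ty (a : gap.{u} p) : Ty := a.down.elim Ty.x fun q => q.2

/-- The top element has default degree `1`, so that degrees are positive without exception, as the
perturbation argument requires. -/
theorem one_le_deg (a : gap.{u} p) : 1 ≤ deg a := by
  rcases a with ⟨_ | ⟨i, T⟩⟩ <;> simp [deg]

theorem deg_le (hp : 1 ≤ p) (a : gap.{u} p) : deg a ≤ p := by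
  rcases a with ⟨_ | ⟨i, T⟩⟩
  · exact hp
  · exact i.2

theorem add_down (a b : gap.{u} p) : (a + b).down = gapAdd a.down b.down := rfl

theorem mul_down (a b : gap.{u} p) : (a * b).down = gapMul a.down b.down := rfl

/-! ### Values of terms in `gap p` read off from their monomials. -/

/-- A monomial contains both a variable of type different from `y` and one of type different
from `x`. -/
def Mixed (v : ℕ → gap.{u} p) (m : Multiset ℕ) : Prop :=
  (∃ z ∈ m, ty (v z) ≠ Ty.x) ∧ ∃ z ∈ m, ty (v z) ≠ Ty.y

/-- The monomials whose value is the top element. -/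
def Bad (v : ℕ → gap.{u} p) (m : Multiset ℕ) : Prop :=
  (∃ z ∈ m, (v z).down = none) ∨ p < weight (fun z => deg (v z)) m ∨
    (weight (fun z => deg (v z)) m = p ∧ 2 ≤ m.card ∧ Mixed v m)

/-- The description, in terms of monomials, of the terms with value of degree `D` and type `T`. -/
structure Spec (v : ℕ → gap.{u} p) (t : Term) (D : ℕ) (T : Ty) : Prop where
  not_bad : ∀ m ∈ t.mons, ¬ Bad v m
  le : ∀ m ∈ t.mons, weight (fun z => deg (v z)) m ≤ D
  exists_top : ∃ m ∈ t.mons, weight (fun z => deg (v z)) m = D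
  ne_x : T ≠ Ty.x ↔
    ∃ m ∈ t.mons, weight (fun z => deg (v z)) m = D ∧ ∃ z ∈ m, ty (v z) ≠ Ty.x
  ne_y : T ≠ Ty.y ↔
    ∃ m ∈ t.mons, weight (fun z => deg (v z)) m = D ∧ ∃ z ∈ m, ty (v z) ≠ Ty.y

/-- Degrees are positive, so a further factor pushes a monomial of weight `p` above `p`. -/
theorem Bad.add_right {v : ℕ → gap.{u} p} {m : Multiset ℕ} (h : Bad v m) {m' : Multiset ℕ}
    (hm' : m' ≠ 0) : Bad v (m + m') := by
  obtain ⟨z, hz⟩ := Multiset.exists_mem_of_ne_zero hm'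
  have h1 := one_le_deg (v z)
  have h2 := le_weight_of_mem (d := fun z => deg (v z)) hz
  rcases h with ⟨z, hz, h⟩ | h | ⟨h, -⟩
  · exact Or.inl ⟨z, Multiset.mem_add.2 (Or.inl hz), h⟩
  · exact Or.inr (Or.inl (by rw [weight_add]; omega))
  · exact Or.inr (Or.inl (by rw [weight_add]; omega))

theorem Spec.add_of_lt {v : ℕ → gap.{u} p} {s t : Term} {D D' : ℕ} {T T' : Ty}
    (hs : Spec v s D T) (ht : Spec v t D' T') (h : D < D') : Spec v (.add s t) D' T' where
  not_bad m hm := (Term.mem_mons_add.1 hm).elim (hs.not_bad m) (ht.not_bad m)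
  le m hm := (Term.mem_mons_add.1 hm).elim (fun h' => (hs.le m h').trans h.le) (ht.le m)
  exists_top := ht.exists_top.imp fun m hm => ⟨Term.mem_mons_add.2 (Or.inr hm.1), hm.2⟩
  ne_x := ht.ne_x.trans (exists_congr fun m => ⟨fun h' => ⟨Term.mem_mons_add.2 (Or.inr h'.1), h'.2⟩,
    fun h' => ⟨(Term.mem_mons_add.1 h'.1).resolve_left
      fun hm => by have := hs.le m hm; have := h'.2.1; omega, h'.2⟩⟩)
  ne_y := ht.ne_y.trans (exists_congr fun m => ⟨fun h' => ⟨Term.mem_mons_add.2 (Or.inr h'.1), h'.2⟩,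
    fun h' => ⟨(Term.mem_mons_add.1 h'.1).resolve_left
      fun hm => by have := hs.le m hm; have := h'.2.1; omega, h'.2⟩⟩)

theorem Spec.congr {v : ℕ → gap.{u} p} {s t : Term} {D : ℕ} {T : Ty}
    (hs : Spec v s D T) (h : s.mons = t.mons) : Spec v t D T :=
  ⟨h ▸ hs.not_bad, h ▸ hs.le, h ▸ hs.exists_top, h ▸ hs.ne_x, h ▸ hs.ne_y⟩

theorem Spec.add_self {v : ℕ → gap.{u} p} {s t : Term} {D : ℕ} {T T' : Ty}
    (hs : Spec v s D T) (ht : Spec v t D T') : Spec v (.add s t) D (T.join T') where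
  not_bad m hm := (Term.mem_mons_add.1 hm).elim (hs.not_bad m) (ht.not_bad m)
  le m hm := (Term.mem_mons_add.1 hm).elim (hs.le m) (ht.le m)
  exists_top := ht.exists_top.imp fun m hm => ⟨Term.mem_mons_add.2 (Or.inr hm.1), hm.2⟩
  ne_x := by
    simp only [Ty.join_ne_x, hs.ne_x, ht.ne_x, Term.mem_mons_add, or_and_right, exists_or]
  ne_y := by
    simp only [Ty.join_ne_y, hs.ne_y, ht.ne_y, Term.mem_mons_add, or_and_right, exists_or]

theorem Spec.exists_top_mul {v : ℕ → gap.{u} p} {s t : Term} {D D' : ℕ} {T T' : Ty}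
    (hs : Spec v s D T) (ht : Spec v t D' T') {P : ℕ → Prop}
    (h : (∃ m ∈ s.mons, weight (fun z => deg (v z)) m = D ∧ ∃ z ∈ m, P z) ∨
      ∃ m ∈ t.mons, weight (fun z => deg (v z)) m = D' ∧ ∃ z ∈ m, P z) :
    ∃ m ∈ (Term.mul s t).mons, weight (fun z => deg (v z)) m = D + D' ∧ ∃ z ∈ m, P z := by
  rcases h with ⟨m, hm, e, z, hz, hP⟩ | ⟨m', hm', e', z, hz, hP⟩
  · obtain ⟨m', hm', e'⟩ := ht.exists_top
    exact ⟨m + m', Term.mem_mons_mul.2 ⟨m, hm, m', hm', rfl⟩, by rw [weight_add, e, e'],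
      z, Multiset.mem_add.2 (Or.inl hz), hP⟩
  · obtain ⟨m, hm, e⟩ := hs.exists_top
    exact ⟨m + m', Term.mem_mons_mul.2 ⟨m, hm, m', hm', rfl⟩, by rw [weight_add, e, e'],
      z, Multiset.mem_add.2 (Or.inr hz), hP⟩

theorem Spec.of_top_mul {v : ℕ → gap.{u} p} {s t : Term} {D D' : ℕ} {T T' : Ty}
    (hs : Spec v s D T) (ht : Spec v t D' T') {P : ℕ → Prop}
    {m : Multiset ℕ} (hm : m ∈ (Term.mul s t).mons)
    (e : weight (fun z => deg (v z)) m = D + D') (h : ∃ z ∈ m, P z) :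
    (∃ m ∈ s.mons, weight (fun z => deg (v z)) m = D ∧ ∃ z ∈ m, P z) ∨
      ∃ m ∈ t.mons, weight (fun z => deg (v z)) m = D' ∧ ∃ z ∈ m, P z := by
  obtain ⟨m₁, h₁, m₂, h₂, rfl⟩ := Term.mem_mons_mul.1 hm
  have l₁ := hs.le m₁ h₁
  have l₂ := ht.le m₂ h₂
  rw [weight_add] at e
  obtain ⟨z, hz, hP⟩ := h
  rcases Multiset.mem_add.1 hz with hz | hz
  · exact Or.inl ⟨m₁, h₁, by omega, z, hz, hP⟩
  · exact Or.inr ⟨m₂, h₂, by omega, z, hz, hP⟩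

theorem Spec.mul {v : ℕ → gap.{u} p} {s t : Term} {D D' : ℕ} {T T' : Ty}
    (hs : Spec v s D T) (ht : Spec v t D' T') (h : D + D' ≤ p)
    (h' : ¬ (D + D' = p ∧ T.join T' = Ty.m)) : Spec v (.mul s t) (D + D') (T.join T') := by
  have hle : ∀ m ∈ (Term.mul s t).mons, weight (fun z => deg (v z)) m ≤ D + D' := by
    intro m hm
    obtain ⟨m₁, h₁, m₂, h₂, rfl⟩ := Term.mem_mons_mul.1 hm
    rw [weight_add]
    exact Nat.add_le_add (hs.le m₁ h₁) (ht.le m₂ h₂)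
  have hx : T.join T' ≠ Ty.x ↔ ∃ m ∈ (Term.mul s t).mons,
      weight (fun z => deg (v z)) m = D + D' ∧ ∃ z ∈ m, ty (v z) ≠ Ty.x := by
    rw [Ty.join_ne_x, hs.ne_x, ht.ne_x]
    exact ⟨fun h => hs.exists_top_mul ht h, fun ⟨m, hm, e, h⟩ => hs.of_top_mul ht hm e h⟩
  have hy : T.join T' ≠ Ty.y ↔ ∃ m ∈ (Term.mul s t).mons,
      weight (fun z => deg (v z)) m = D + D' ∧ ∃ z ∈ m, ty (v z) ≠ Ty.y := by
    rw [Ty.join_ne_y, hs.ne_y, ht.ne_y]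
    exact ⟨fun h => hs.exists_top_mul ht h, fun ⟨m, hm, e, h⟩ => hs.of_top_mul ht hm e h⟩
  refine ⟨fun m hm hb => ?_, hle, ?_, hx, hy⟩
  · rcases hb with ⟨z, hz, hn⟩ | hlt | ⟨e, -, hmx, hmy⟩
    · obtain ⟨m₁, h₁, m₂, h₂, rfl⟩ := Term.mem_mons_mul.1 hm
      rcases Multiset.mem_add.1 hz with hz | hz
      · exact hs.not_bad m₁ h₁ (Or.inl ⟨z, hz, hn⟩)
      · exact ht.not_bad m₂ h₂ (Or.inl ⟨z, hz, hn⟩)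
    · have := hle m hm
      omega
    -- A mixed monomial of weight `p` is of maximal weight, so its variables force the joined type
    -- to be `m`, which `h'` excludes.
    · have h1 := hle m hm
      have h2 : D + D' = p := by omega
      exact h' ⟨h2, Ty.eq_m (hx.2 ⟨m, hm, by omega, hmx⟩) (hy.2 ⟨m, hm, by omega, hmy⟩)⟩
  · obtain ⟨m₁, h₁, e₁⟩ := hs.exists_top
    obtain ⟨m₂, h₂, e₂⟩ := ht.exists_top
    exact ⟨m₁ + m₂, Term.mem_mons_mul.2 ⟨m₁, h₁, m₂, h₂, rfl⟩, by rw [weight_add, e₁, e₂]⟩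

/-- If the joined type is `m`, one factor has a top monomial with a variable not of type `x` and the
other one with a variable not of type `y`. Their product is mixed and has at least two letters. -/
theorem Spec.bad_mul {v : ℕ → gap.{u} p} {s t : Term} {D D' : ℕ} {T T' : Ty}
    (hs : Spec v s D T) (ht : Spec v t D' T')
    (h' : p < D + D' ∨ (D + D' = p ∧ T.join T' = Ty.m)) :
    ∃ m ∈ (Term.mul s t).mons, Bad v m := by
  have key : ∀ m₁ ∈ s.mons, weight (fun z => deg (v z)) m₁ = D → ∀ m₂ ∈ t.mons,
      weight (fun z => deg (v z)) m₂ = D' → D + D' = p → Mixed v (m₁ + m₂) →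
      ∃ m ∈ (Term.mul s t).mons, Bad v m := by
    intro m₁ h₁ e₁ m₂ h₂ e₂ e hmix
    refine ⟨m₁ + m₂, Term.mem_mons_mul.2 ⟨m₁, h₁, m₂, h₂, rfl⟩,
      Or.inr (Or.inr ⟨by rw [weight_add, e₁, e₂, e], ?_, hmix⟩)⟩
    have c₁ := Multiset.card_pos.2 (s.ne_zero_of_mem_mons m₁ h₁)
    have c₂ := Multiset.card_pos.2 (t.ne_zero_of_mem_mons m₂ h₂)
    rw [Multiset.card_add]
    omega
  have hl : ∀ {m₁ m₂ : Multiset ℕ} {P : ℕ → Prop}, (∃ z ∈ m₁, P z) → ∃ z ∈ m₁ + m₂, P z :=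
    fun ⟨z, hz, h⟩ => ⟨z, Multiset.mem_add.2 (Or.inl hz), h⟩
  have hr : ∀ {m₁ m₂ : Multiset ℕ} {P : ℕ → Prop}, (∃ z ∈ m₂, P z) → ∃ z ∈ m₁ + m₂, P z :=
    fun ⟨z, hz, h⟩ => ⟨z, Multiset.mem_add.2 (Or.inr hz), h⟩
  rcases h' with h' | ⟨e, hm⟩
  · obtain ⟨m₁, h₁, e₁⟩ := hs.exists_top
    obtain ⟨m₂, h₂, e₂⟩ := ht.exists_top
    exact ⟨m₁ + m₂, Term.mem_mons_mul.2 ⟨m₁, h₁, m₂, h₂, rfl⟩,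
      Or.inr (Or.inl (by rw [weight_add, e₁, e₂]; exact h'))⟩
  · have hjx := (Ty.join_ne_x T T').1 (by rw [hm]; simp)
    have hjy := (Ty.join_ne_y T T').1 (by rw [hm]; simp)
    have mixed : (T ≠ Ty.x ∧ T' ≠ Ty.y) ∨ (T ≠ Ty.y ∧ T' ≠ Ty.x) := by
      revert hjx hjy
      cases T <;> cases T' <;> simp
    rcases mixed with ⟨h1, h2⟩ | ⟨h1, h2⟩
    · obtain ⟨m₁, h₁, e₁, z₁⟩ := hs.ne_x.1 h1
      obtain ⟨m₂, h₂, e₂, z₂⟩ := ht.ne_y.1 h2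
      exact key m₁ h₁ e₁ m₂ h₂ e₂ e ⟨hl z₁, hr z₂⟩
    · obtain ⟨m₁, h₁, e₁, z₁⟩ := hs.ne_y.1 h1
      obtain ⟨m₂, h₂, e₂, z₂⟩ := ht.ne_x.1 h2
      exact key m₁ h₁ e₁ m₂ h₂ e₂ e ⟨hr z₂, hl z₁⟩

/-- Induction on the term. The top element absorbs and badness of a monomial survives
multiplication. Otherwise the monomials of maximal weight of a product are the products of those of
the factors, so degrees add and types join. -/
theorem eval_spec (v : ℕ → gap.{u} p) (t : Term) :
    ((t.eval v).down = none ∧ ∃ m ∈ t.mons, Bad v m) ∨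
      ∃ i T, (t.eval v).down = some (i, T) ∧ Spec v t (i.1 + 1) T := by
  induction t with
  | var n =>
    rcases hn : (v n).down with _ | ⟨i, T⟩
    · exact Or.inl ⟨hn, {n}, by simp [Term.mons], Or.inl ⟨n, by simp, hn⟩⟩
    · have hd : deg (v n) = i.1 + 1 := by simp [deg, hn]
      have hT : ty (v n) = T := by simp [ty, hn]
      have hi := i.2
      refine Or.inr ⟨i, T, hn, ⟨?_, ?_, ?_, ?_, ?_⟩⟩
      · simp [Term.mons, Bad, hn, hd]
      · simp [Term.mons, hd]
      · simp [Term.mons, hd]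
      · simp [Term.mons, hd, hT]
      · simp [Term.mons, hd, hT]
  | add s t hs ht =>
    rcases hs with ⟨es, m, hm, hb⟩ | ⟨i, T, es, hs⟩
    · refine Or.inl ⟨?_, m, Term.mem_mons_add.2 (Or.inl hm), hb⟩
      rw [Term.eval, add_down, es]; rfl
    rcases ht with ⟨et, m, hm, hb⟩ | ⟨j, U, et, ht⟩
    · refine Or.inl ⟨?_, m, Term.mem_mons_add.2 (Or.inr hm), hb⟩
      rw [Term.eval, add_down, es, et]; rfl
    right
    have hsum : ((Term.add s t).eval v).down =
        if i < j then some (j, U) else if j < i then some (i, T) else some (i, T.join U) := by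
      rw [Term.eval, add_down, es, et]; rfl
    rw [hsum]
    rcases lt_trichotomy i j with h | h | h
    · exact ⟨j, U, if_pos h, hs.add_of_lt ht (by simpa using h)⟩
    · subst h
      exact ⟨i, T.join U, by simp, hs.add_self ht⟩
    · refine ⟨i, T, by rw [if_neg h.not_gt, if_pos h],
        (ht.add_of_lt hs (by simpa using h)).congr ?_⟩
      exact Finset.union_comm _ _
  | mul s t hs ht =>
    rcases hs with ⟨es, m, hm, hb⟩ | ⟨i, T, es, hs⟩
    · obtain ⟨m', hm'⟩ := t.mons_nonempty
      refine Or.inl ⟨?_, m + m', Term.mem_mons_mul.2 ⟨m, hm, m', hm', rfl⟩,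
        hb.add_right (t.ne_zero_of_mem_mons m' hm')⟩
      rw [Term.eval, mul_down, es]; rfl
    rcases ht with ⟨et, m, hm, hb⟩ | ⟨j, U, et, ht⟩
    · obtain ⟨m', hm'⟩ := s.mons_nonempty
      refine Or.inl ⟨?_, m + m', Term.mem_mons_mul.2 ⟨m', hm', m, hm, add_comm _ _⟩,
        hb.add_right (s.ne_zero_of_mem_mons m' hm')⟩
      rw [Term.eval, mul_down, es, et]; rfl
    have hprod : ((Term.mul s t).eval v).down =
        if h : i.1 + j.1 + 1 < p ∧ ¬ (i.1 + j.1 + 2 = p ∧ T.join U = Ty.m) then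
        some (⟨i.1 + j.1 + 1, h.1⟩, T.join U) else none := by
      rw [Term.eval, mul_down, es, et]; rfl
    rw [hprod]
    by_cases h : i.1 + j.1 + 1 < p ∧ ¬ (i.1 + j.1 + 2 = p ∧ T.join U = Ty.m)
    · right
      have e : i.1 + j.1 + 1 + 1 = (i.1 + 1) + (j.1 + 1) := by ring
      refine ⟨⟨i.1 + j.1 + 1, h.1⟩, T.join U, dif_pos h, ?_⟩
      simp only [e]
      exact hs.mul ht (by have := h.1; omega) fun h' => h.2 ⟨by have := h'.1; omega, h'.2⟩
    · left
      refine ⟨dif_neg h, hs.bad_mul ht ?_⟩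
      by_cases h1 : T.join U = Ty.m
      · simp only [h1, and_true] at h ⊢
        omega
      · simp only [h1, and_false, not_false_eq_true, and_true, or_false] at h ⊢
        omega

/-! ### Witnesses of failure, and why a witness determines the prime. -/

/-- The combinatorial trace of a failure in `gap p` of an identity of the max-plus algebra: the
monomials `S` of maximal weight on one side are either over the variables in `X` or avoid them, and
`m'` is a monomial of the other side with the same weight and with a nontrivial part over `X`. -/
def Witness (s t : Term) (p : ℕ) (q : Finset (Multiset ℕ) × Multiset ℕ × Finset ℕ) : Prop :=
  ∃ d : ℕ → ℕ, (∀ z, 1 ≤ d z) ∧ (∀ z, d z ≤ p) ∧ (∀ m ∈ s.mons, weight d m ≤ p) ∧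
    q.1 = s.mons.filter (fun m => weight d m = p) ∧
    (∀ m ∈ q.1, (∀ z ∈ m, z ∈ q.2.2) ∨ ∀ z ∈ m, z ∉ q.2.2) ∧
    q.2.1 ∈ t.mons ∧ weight d q.2.1 = p ∧
    0 < weight (fun z => if z ∈ q.2.2 then d z else 0) q.2.1 ∧
    weight (fun z => if z ∈ q.2.2 then d z else 0) q.2.1 < p

/-- The possible data of witnesses. -/
def traces (s t : Term) : Finset (Finset (Multiset ℕ) × Multiset ℕ × Finset ℕ) :=
  s.mons.powerset ×ˢ t.mons ×ˢ ((s.mons ∪ t.mons).biUnion Multiset.toFinset).powerset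

theorem weight_int_combination (a b : ℕ) (d₁ d₂ : ℕ → ℕ) (m : Multiset ℕ) :
    weight (fun z => (a : ℤ) * d₁ z - b * d₂ z) m =
      a * (weight d₁ m : ℕ) - b * (weight d₂ m : ℕ) := by
  induction m using Multiset.induction_on with
  | empty => simp [weight]
  | cons z m ih =>
    rw [← Multiset.singleton_add]
    simp only [weight_add, weight_singleton, ih]
    push_cast
    ring

theorem weight_neg (ε : ℕ → ℤ) (m : Multiset ℕ) : weight (fun z => - ε z) m = - weight ε m := by
  simp [weight]

theorem weight_restrict_of_subset {X : Finset ℕ} {d : ℕ → ℕ} {m : Multiset ℕ}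
    (h : ∀ z ∈ m, z ∈ X) : weight (fun z => if z ∈ X then d z else 0) m = weight d m := by
  unfold weight
  rw [Multiset.map_congr rfl fun z hz => if_pos (h z hz)]

theorem weight_restrict_of_disjoint {X : Finset ℕ} {d : ℕ → ℕ} {m : Multiset ℕ}
    (h : ∀ z ∈ m, z ∉ X) : weight (fun z => if z ∈ X then d z else 0) m = 0 := by
  unfold weight
  rw [Multiset.map_congr rfl fun z hz => if_neg (h z hz)]
  simp

/-- Two distinct primes cannot share a witness. -/
theorem Witness.prime_unique {s t : Term} (hst : ∀ v, s.maxPlusVal v = t.maxPlusVal v)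
    {p₁ p₂ : ℕ} (hp₁ : p₁.Prime) (hp₂ : p₂.Prime)
    {q : Finset (Multiset ℕ) × Multiset ℕ × Finset ℕ} (h₁ : Witness s t p₁ q)
    (h₂ : Witness s t p₂ q) : p₁ = p₂ := by
  obtain ⟨S, m', X⟩ := q
  obtain ⟨d₁, hd₁, hd₁p, hle₁, hS₁, hX, hm', hw₁, hpos₁, hlt₁⟩ := h₁
  obtain ⟨d₂, hd₂, hd₂p, hle₂, hS₂, -, -, hw₂, hpos₂, hlt₂⟩ := h₂
  simp only at *
  set e₁ : ℕ → ℕ := fun z => if z ∈ X then d₁ z else 0 with he₁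
  set e₂ : ℕ → ℕ := fun z => if z ∈ X then d₂ z else 0 with he₂
  have hb₁ : ∀ z, e₁ z ≤ p₁ := fun z => by
    have := hd₁p z
    simp only [he₁]
    split_ifs <;> omega
  have hb₂ : ∀ z, e₂ z ≤ p₂ := fun z => by
    have := hd₂p z
    simp only [he₂]
    split_ifs <;> omega
  -- On a monomial of `S` the pair of weights under `e₁`, `e₂` is `(p₁, p₂)` or `(0, 0)`, so this
  -- functional vanishes there.
  set ε : ℕ → ℤ := fun z => (p₁ : ℤ) * e₂ z - p₂ * e₁ z with hε
  have hbound : ∀ z, |ε z| ≤ (p₁ * p₂ : ℕ) := by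
    intro z
    have h1 : p₁ * e₂ z ≤ p₁ * p₂ := Nat.mul_le_mul_left _ (hb₂ z)
    have h2 : p₂ * e₁ z ≤ p₁ * p₂ := by
      rw [mul_comm p₁]
      exact Nat.mul_le_mul_left _ (hb₁ z)
    zify at h1 h2
    have h3 : (0 : ℤ) ≤ p₁ * e₂ z := by positivity
    have h4 : (0 : ℤ) ≤ p₂ * e₁ z := by positivity
    rw [abs_le]
    push_cast
    constructor <;> simp only [hε] <;> linarith
  have hzero : ∀ m ∈ S, weight ε m = 0 := by
    intro m hm
    rw [hε, weight_int_combination]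
    rcases hX m hm with h | h
    · rw [he₁, he₂, weight_restrict_of_subset h, weight_restrict_of_subset h]
      have h1 : weight d₁ m = p₁ := by
        rw [hS₁] at hm
        exact (Finset.mem_filter.1 hm).2
      have h2 : weight d₂ m = p₂ := by
        rw [hS₂] at hm
        exact (Finset.mem_filter.1 hm).2
      rw [h1, h2]
      ring
    · rw [he₁, he₂, weight_restrict_of_disjoint h, weight_restrict_of_disjoint h]
      simp
  -- Perturbing in the directions `ε` and `-ε` gives both inequalities.
  have hle : weight ε m' ≤ 0 := by
    obtain ⟨m, hm, hmp, h⟩ := exists_top_of_perturb hst hd₁ hle₁ hm' hw₁ hbound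
    rwa [hzero m (by rw [hS₁]; exact Finset.mem_filter.2 ⟨hm, hmp⟩)] at h
  have hge : 0 ≤ weight ε m' := by
    obtain ⟨m, hm, hmp, h⟩ := exists_top_of_perturb hst hd₁ hle₁ hm' hw₁
      (ε := fun z => - ε z) (fun z => by rw [abs_neg]; exact hbound z)
    rw [weight_neg, weight_neg,
      hzero m (by rw [hS₁]; exact Finset.mem_filter.2 ⟨hm, hmp⟩)] at h
    linarith
  have heq : weight ε m' = 0 := le_antisymm hle hge
  rw [hε, weight_int_combination, sub_eq_zero] at heq
  have heq' : p₁ * weight e₂ m' = p₂ * weight e₁ m' := by exact_mod_cast heq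
  have hdvd : p₁ ∣ p₂ * weight e₁ m' := ⟨_, heq'.symm⟩
  rcases hp₁.dvd_mul.1 hdvd with h | h
  · exact (Nat.prime_dvd_prime_iff_eq hp₁ hp₂).1 h
  · exact absurd (Nat.le_of_dvd hpos₁ h) (by omega)

theorem weight_restrict_lt {X : Finset ℕ} {d : ℕ → ℕ} (hd : ∀ z, 1 ≤ d z) {m : Multiset ℕ}
    {z : ℕ} (hz : z ∈ m) (hzX : z ∉ X) :
    weight (fun z => if z ∈ X then d z else 0) m < weight d m := by
  obtain ⟨m, rfl⟩ := Multiset.exists_cons_of_mem hz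
  rw [← Multiset.singleton_add, weight_add, weight_add, weight_singleton, weight_singleton,
    if_neg hzX]
  have h : weight (fun z => if z ∈ X then d z else 0) m ≤ weight d m :=
    Multiset.sum_map_le_sum_map _ _ fun w _ => by split_ifs <;> simp
  have := hd z
  omega

/-- If both sides of an identity of the max-plus algebra have different values in `gap p`, one of
them not the top element, then there is a witness. -/
theorem exists_witness {s t : Term} (hst : ∀ v, s.maxPlusVal v = t.maxPlusVal v) (hp : 1 ≤ p)
    (v : ℕ → gap.{u} p) (hne : s.eval v ≠ t.eval v) (hs : (s.eval v).down ≠ none) :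
    ∃ q ∈ traces s t, Witness s t p q := by
  classical
  set d : ℕ → ℕ := fun z => deg (v z) with hd
  have hd1 : ∀ z, 1 ≤ d z := fun z => one_le_deg _
  obtain ⟨i, T, es, hs⟩ := (eval_spec v s).resolve_left fun h => hs h.1
  -- Degrees form an assignment in max-plus, so both sides have the same maximal weight.
  have htle : ∀ m ∈ t.mons, weight d m ≤ i.1 + 1 := by
    intro m hm
    refine (t.weight_le_maxPlusVal d m hm).trans ?_
    obtain ⟨m₀, hm₀, e₀⟩ := s.exists_weight_eq_maxPlusVal d
    rw [← hst d, ← e₀]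
    exact hs.le m₀ hm₀
  have httop : ∃ m ∈ t.mons, weight d m = i.1 + 1 := by
    obtain ⟨m₀, hm₀, e₀⟩ := t.exists_weight_eq_maxPlusVal d
    refine ⟨m₀, hm₀, le_antisymm (htle m₀ hm₀) ?_⟩
    obtain ⟨m₁, hm₁, e₁⟩ := hs.exists_top
    rw [e₀, ← hst d, ← e₁]
    exact s.weight_le_maxPlusVal d m₁ hm₁
  have hipl := i.2
  have transfer : ∀ {m' : Multiset ℕ}, m' ∈ t.mons → weight d m' = i.1 + 1 → ∀ P : ℕ → Prop,
      (∃ z ∈ m', P z) → ∃ m ∈ s.mons, weight d m = i.1 + 1 ∧ ∃ z ∈ m, P z :=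
    fun hm' hw P hP => exists_top_mem hst hd1 hs.le hm' hw P hP
  have transfer' : ∀ {m' : Multiset ℕ}, m' ∈ s.mons → weight d m' = i.1 + 1 → ∀ P : ℕ → Prop,
      (∃ z ∈ m', P z) → ∃ m ∈ t.mons, weight d m = i.1 + 1 ∧ ∃ z ∈ m, P z :=
    fun hm' hw P hP => exists_top_mem (fun v => (hst v).symm) hd1 htle hm' hw P hP
  rcases eval_spec v t with ⟨-, m', hm', hbad⟩ | ⟨j, U, et, ht⟩
  swap
  · refine absurd ?_ hne
    have hij : i.1 + 1 = j.1 + 1 := by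
      obtain ⟨m₀, hm₀, e₀⟩ := httop
      obtain ⟨m₁, hm₁, e₁⟩ := ht.exists_top
      exact le_antisymm (e₀ ▸ ht.le m₀ hm₀) (e₁ ▸ htle m₁ hm₁)
    obtain rfl : i = j := Fin.ext (by omega)
    have hTU : T = U := by
      refine Ty.eq_of_iff ?_ ?_
      · rw [hs.ne_x, ht.ne_x]
        exact ⟨fun ⟨m, hm, e, h⟩ => transfer' hm e _ h, fun ⟨m, hm, e, h⟩ => transfer hm e _ h⟩
      · rw [hs.ne_y, ht.ne_y]
        exact ⟨fun ⟨m, hm, e, h⟩ => transfer' hm e _ h, fun ⟨m, hm, e, h⟩ => transfer hm e _ h⟩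
    subst hTU
    exact ULift.ext _ _ (es.trans et.symm)
  -- Variables and maximal weights agree on both sides, so only the third kind of bad monomial,
  -- mixed of weight `p`, can be absent from `s`.
  rcases hbad with ⟨z, hz, hn⟩ | hlt | ⟨hw, hcard, ⟨z₁, hz₁, hz₁x⟩, z₂, hz₂, hz₂y⟩
  · obtain ⟨m, hm, hzm⟩ := exists_mem_of_mem hst hm' hz
    exact absurd (Or.inl ⟨z, hzm, hn⟩) (hs.not_bad m hm)
  · exact absurd (htle m' hm') (by simp only [hd]; omega)
  have hip : i.1 + 1 = p := by
    have := htle m' hm'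
    simp only [hd] at this
    omega
  rw [hip] at transfer
  -- A variable `z` of type `m` in `m'` occurs in a top monomial of `s`, which is not bad and hence
  -- is `z` alone. Then `z` has degree `p`, leaving no room for the other letters of `m'`.
  have hpure : ∀ z ∈ m', ty (v z) ≠ Ty.m := by
    intro z hz hzm
    obtain ⟨m, hm, hmp, _, hzm', rfl⟩ := transfer hm' hw (fun w => w = z) ⟨z, hz, rfl⟩
    have hc : m.card < 2 := by
      by_contra hc
      exact hs.not_bad m hm (Or.inr (Or.inr ⟨hmp, by omega, ⟨_, hzm', by simp [hzm]⟩,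
        ⟨_, hzm', by simp [hzm]⟩⟩))
    obtain ⟨m, rfl⟩ := Multiset.exists_cons_of_mem hzm'
    rw [Multiset.card_cons] at hc
    obtain rfl : m = 0 := Multiset.card_eq_zero.1 (by omega)
    obtain ⟨m', rfl⟩ := Multiset.exists_cons_of_mem hz
    rw [Multiset.card_cons] at hcard
    obtain ⟨w, hw'⟩ := Multiset.card_pos_iff_exists_mem.1 (show 0 < m'.card by omega)
    have h1 := le_weight_of_mem (d := d) hw'
    have h2 := hd1 w
    rw [← Multiset.singleton_add, weight_add] at hw
    change weight d {_} = p at hmp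
    change weight d {_} + weight d m' = p at hw
    omega
  set X : Finset ℕ := ((s.mons ∪ t.mons).biUnion Multiset.toFinset).filter
    (fun z => ty (v z) = Ty.x) with hX
  have memX : ∀ m ∈ s.mons ∪ t.mons, ∀ z ∈ m, (z ∈ X ↔ ty (v z) = Ty.x) := by
    intro m hm z hz
    rw [hX, Finset.mem_filter, and_iff_right_iff_imp]
    exact fun _ => Finset.mem_biUnion.2 ⟨m, hm, Multiset.mem_toFinset.2 hz⟩
  have hm'U : m' ∈ s.mons ∪ t.mons := Finset.mem_union_right _ hm'
  have hz₁X : z₁ ∉ X := fun h => hz₁x ((memX m' hm'U z₁ hz₁).1 h)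
  have hz₂X : z₂ ∈ X := (memX m' hm'U z₂ hz₂).2 (by
    have := hpure z₂ hz₂
    revert this hz₂y
    cases ty (v z₂) <;> simp)
  refine ⟨(s.mons.filter (fun m => weight d m = p), m', X), ?_, d, hd1,
    fun z => deg_le hp _, fun m hm => (hs.le m hm).trans hip.le, rfl, ?_, hm', hw, ?_, ?_⟩
  · refine Finset.mem_product.2 ⟨?_, Finset.mem_product.2 ⟨hm', ?_⟩⟩
    · exact Finset.mem_powerset.2 (Finset.filter_subset _ _)
    · exact Finset.mem_powerset.2 (Finset.filter_subset _ _)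
  · intro m hm
    obtain ⟨hm, hmp⟩ := Finset.mem_filter.1 hm
    have hmU : m ∈ s.mons ∪ t.mons := Finset.mem_union_left _ hm
    by_cases hc : 2 ≤ m.card
    · have hmix : ¬ Mixed v m := fun h => hs.not_bad m hm (Or.inr (Or.inr ⟨hmp, hc, h⟩))
      by_cases hx : ∃ z ∈ m, ty (v z) ≠ Ty.x
      · right
        intro z hz hzX
        exact hmix ⟨hx, z, hz, by rw [(memX m hmU z hz).1 hzX]; simp⟩
      · left
        push Not at hx
        exact fun z hz => (memX m hmU z hz).2 (hx z hz)
    -- A single letter of degree `p` may have type `m` without being bad, but it lies in `X` or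
    -- outside it anyway.
    · have hc' := Multiset.card_pos.2 (s.ne_zero_of_mem_mons m hm)
      obtain ⟨w, rfl⟩ := Multiset.card_eq_one.1 (show m.card = 1 by omega)
      simp only [Multiset.mem_singleton, forall_eq]
      exact em _
  · have h1 := le_weight_of_mem (d := fun z => if z ∈ X then d z else 0) hz₂
    simp only [if_pos hz₂X] at h1
    exact (hd1 z₂).trans h1
  · exact (weight_restrict_lt hd1 hz₁ hz₁X).trans_eq hw

/-- There are finitely many traces, and each serves at most one prime. -/
theorem finite_primes_exists_witness {s t : Term}
    (hst : ∀ v, s.maxPlusVal v = t.maxPlusVal v) :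
    {p : ℕ | p.Prime ∧ ∃ q ∈ traces s t, Witness s t p q}.Finite := by
  have : {p : ℕ | p.Prime ∧ ∃ q ∈ traces s t, Witness s t p q} =
      ⋃ q ∈ traces s t, {p : ℕ | p.Prime ∧ Witness s t p q} := by
    ext p
    simp only [Set.mem_ofPred_eq, Set.mem_iUnion]
    exact ⟨fun ⟨hp, q, hq, h⟩ => ⟨q, hq, hp, h⟩, fun ⟨q, hq, hp, h⟩ => ⟨hp, q, hq, h⟩⟩
  rw [this]
  exact (traces s t).finite_toSet.biUnion fun q _ => Set.Subsingleton.finite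
    fun p₁ h₁ p₂ h₂ => Witness.prime_unique hst h₁.1 h₂.1 h₁.2 h₂.2

/-- Every identity of the max-plus algebra holds in `gap p` for all but finitely many primes. -/
theorem finite_primes_not_satisfies {e : Term × Term} (he : Satisfies maxPlus.{u} e) :
    {p : ℕ | p.Prime ∧ ¬ Satisfies (gap.{u} p) e}.Finite := by
  obtain ⟨s, t⟩ := e
  rw [satisfies_maxPlus_iff] at he
  simp only at he
  have he' : ∀ v, t.maxPlusVal v = s.maxPlusVal v := fun v => (he v).symm
  refine ((finite_primes_exists_witness he).union
    (finite_primes_exists_witness he')).subset ?_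
  rintro p ⟨hp, hn⟩
  simp only [Satisfies, not_forall] at hn
  obtain ⟨v, hv⟩ := hn
  by_cases hs : (s.eval v).down = none
  · by_cases ht : (t.eval v).down = none
    · exact absurd (ULift.ext _ _ (hs.trans ht.symm)) hv
    · exact Or.inr ⟨hp, exists_witness he' hp.one_le v (Ne.symm hv) ht⟩
  · exact Or.inl ⟨hp, exists_witness he hp.one_le v hv hs⟩

end gap

/-! ### The max-plus algebra is not finitely based -/

/-- The power with exponent `n + 1`. -/
def Term.powSucc (t : Term) : ℕ → Term
  | 0 => t
  | n + 1 => .mul (t.powSucc n) t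

theorem Term.maxPlusVal_powSucc (v : ℕ → ℕ) (t : Term) (n : ℕ) :
    (t.powSucc n).maxPlusVal v = (n + 1) * t.maxPlusVal v := by
  induction n with
  | zero => simp [powSucc]
  | succ n ih => rw [powSucc, maxPlusVal, ih]; ring

/-- The identity `(x + y) ^ (n + 1) ≈ x ^ (n + 1) + y ^ (n + 1)`. -/
def freshman (n : ℕ) : Term × Term :=
  ((Term.add (.var 0) (.var 1)).powSucc n,
    .add ((Term.var 0).powSucc n) ((Term.var 1).powSucc n))

theorem satisfies_maxPlus_freshman (n : ℕ) : Satisfies maxPlus.{u} (freshman n) := by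
  rw [satisfies_maxPlus_iff]
  intro v
  simp only [freshman, Term.maxPlusVal, Term.maxPlusVal_powSucc]
  exact Nat.mul_max_mul_left _ _ _ |>.symm

/-- An element of degree one keeps its type under powers. Only the power of maximal degree `p + 1`
needs a type other than `m`. -/
theorem gap.eval_powSucc {p : ℕ} (v : ℕ → gap.{u} (p + 1)) (t : Term) (T : Ty)
    (ht : (t.eval v).down = some (0, T)) {n : ℕ} (hn : n < p ∨ (n ≤ p ∧ T ≠ Ty.m)) :
    ((t.powSucc n).eval v).down = some (⟨n, by omega⟩, T) := by
  induction n with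
  | zero => exact ht
  | succ n ih =>
    rw [Term.powSucc, Term.eval, gap.mul_down, ih (by omega), ht]
    have hj : T.join T = T := by simp [Ty.join]
    have hc : n + (0 : Fin (p + 1)).1 + 1 < p + 1 ∧
        ¬ (n + (0 : Fin (p + 1)).1 + 2 = p + 1 ∧ T.join T = Ty.m) := by
      rw [hj]
      simp only [Fin.val_zero, add_zero]
      refine ⟨by omega, fun h => ?_⟩
      rcases hn with hn | hn
      · omega
      · exact hn.2 h.2
    simp only [gapMul]
    rw [dif_pos hc]
    simp [hj]

theorem gap.not_satisfies_freshman (p : ℕ) :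
    ¬ Satisfies (gap.{u} (p + 2)) (freshman (p + 1)) := by
  intro h
  let v : ℕ → gap.{u} (p + 2) := fun n => ⟨some (0, if n = 0 then Ty.x else Ty.y)⟩
  have h0 := gap.eval_powSucc v (.var 0) Ty.x rfl (n := p + 1) (Or.inr ⟨le_rfl, by simp⟩)
  have h1 := gap.eval_powSucc v (.var 1) Ty.y rfl (n := p + 1) (Or.inr ⟨le_rfl, by simp⟩)
  -- The sum of the two generators has type `m`, so its powers survive up to exponent `p + 1`; the
  -- next one is the top element. On the other side two pure powers of degree `p + 2` add up to an
  -- element of type `m`, which is allowed.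
  have h2 := gap.eval_powSucc v (.add (.var 0) (.var 1)) Ty.m rfl (n := p)
    (Or.inl (Nat.lt_succ_self p))
  have hl : (((Term.add (.var 0) (.var 1)).powSucc (p + 1)).eval v).down = none := by
    rw [Term.powSucc, Term.eval, gap.mul_down, h2]
    have : (Term.eval v (.add (.var 0) (.var 1))).down = some (0, Ty.m) := rfl
    rw [this]
    simp [gapMul, Ty.join]
  have hr : ((Term.add ((Term.var 0).powSucc (p + 1)) ((Term.var 1).powSucc (p + 1))).eval
      v).down ≠ none := by
    rw [Term.eval, gap.add_down, h0, h1]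
    simp [gapAdd]
  exact hr ((congrArg ULift.down (h v)).symm.trans hl)

theorem not_finitelyBased_variety_maxPlus :
    ¬ FinitelyBased (variety {maxPlus.{u}}) := by
  rintro ⟨E, hE, hV⟩
  have hmax : ∀ e ∈ E, Satisfies maxPlus.{u} e := by
    have h : maxPlus.{u} ∈ variety {maxPlus.{u}} := subset_variety _ rfl
    rw [hV] at h
    exact h
  have hfin : (⋃ e ∈ E, {p : ℕ | p.Prime ∧ ¬ Satisfies (gap.{u} p) e}).Finite :=
    hE.biUnion fun e he => gap.finite_primes_not_satisfies (hmax e he)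
  obtain ⟨p, hp, hpE⟩ := Nat.infinite_setOfPred_prime.exists_notMem_finite hfin
  have hgap : gap.{u} p ∈ variety {maxPlus.{u}} := by
    rw [hV]
    intro e he
    by_contra hne
    exact hpE (Set.mem_biUnion he ⟨hp, hne⟩)
  obtain ⟨n, rfl⟩ := Nat.exists_eq_add_of_le' hp.two_le
  exact gap.not_satisfies_freshman n
    (satisfies_of_mem_variety (satisfies_maxPlus_freshman (n + 1)) hgap)


/-! ### Two-element flat semirings -/

/-- The set `{1, 0}` with `x + y = 0` for `x ≠ y`, and with `1 * 1 = 1` (if `b`) or all products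
equal to `0` (otherwise); here `1` is `True` and `0` is `False`. -/
def two (b : Prop) : Alg.{u} where
  carrier := ULift.{u} Prop
  add := ⟨fun x y => ⟨x.down ∧ y.down⟩⟩
  mul := ⟨fun x y => ⟨b ∧ x.down ∧ y.down⟩⟩

/-- The pair `{a, z}` is a subalgebra. The parameter `b` is a proposition so that `c * c = c` can be
inserted directly later. -/
theorem two_mem_of_pair {V : Set Alg.{u}} (hV : IsVariety V) {A : Alg.{u}} (hA : A ∈ V)
    {z a : A} (hza : a ≠ z) (hz : ∀ x : A, z * x = z ∧ x * z = z) (hadd : a + z = z)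
    (hadd' : z + a = z) (haa : a + a = a) (hzz : z + z = z) {b : Prop}
    (hb : b → a * a = a) (hb' : ¬ b → a * a = z) :
    two.{u} b ∈ V := by
  classical
  let f : Prop → A := fun x => if x then a else z
  have hT : ∀ {x : Prop}, x → f x = a := fun h => if_pos h
  have hF : ∀ {x : Prop}, ¬ x → f x = z := fun h => if_neg h
  refine hV.subalgebra (two b) A (fun x => f x.down) hA ⟨?_, ?_⟩ ?_
  · rintro ⟨x⟩ ⟨y⟩
    change f (x ∧ y) = f x + f y
    by_cases hx : x
    · by_cases hy : y
      · rw [hT hx, hT hy, hT ⟨hx, hy⟩, haa]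
      · rw [hT hx, hF hy, hF fun h => hy h.2, hadd]
    · by_cases hy : y
      · rw [hF hx, hT hy, hF fun h => hx h.1, hadd']
      · rw [hF hx, hF hy, hF fun h => hx h.1, hzz]
  · rintro ⟨x⟩ ⟨y⟩
    change f (b ∧ x ∧ y) = f x * f y
    by_cases hx : x
    · by_cases hy : y
      · rw [hT hx, hT hy]
        by_cases h : b
        · rw [hT ⟨h, hx, hy⟩, hb h]
        · rw [hF fun h' => h h'.1, hb' h]
      · rw [hF hy, hF fun h => hy h.2.2, (hz _).2]
    · rw [hF hx, hF fun h => hx h.2.1, (hz _).1]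
  · rintro ⟨x⟩ ⟨y⟩ h
    change f x = f y at h
    refine ULift.ext _ _ (propext ⟨fun hx => ?_, fun hy => ?_⟩)
    · by_contra hy
      exact hza (by rw [← hT hx, h, hF hy])
    · by_contra hx
      exact hza (by rw [← hT hy, ← h, hF hx])

theorem IsFlatSemiring.two_mem {V : Set Alg.{u}} (hV : IsVariety V) {A : Alg.{u}} (hA : A ∈ V)
    (hf : IsAISemiring A) {z : A} (hz : ∀ a : A, z * a = z ∧ a * z = z)
    (hadd : ∀ a b : A, a ≠ b → a + b = z) {a : A} (ha : a ≠ z) {b : Prop}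
    (hb : b → a * a = a) (hb' : ¬ b → a * a = z) : two.{u} b ∈ V :=
  two_mem_of_pair hV hA ha hz (hadd a z ha) (hadd z a ha.symm) (hf.add_idem a)
    (hf.add_idem z) hb hb'

theorem two_false_mem_Sa {V : Set Alg.{u}} (hV : IsVariety V) (h : Sa ∈ V) :
    two.{u} False ∈ V := by
  have hmem : [PUnit.unit.{u + 1}] ∈ {w : List PUnit.{u + 1} | w ≠ [] ∧
      ∃ w' ∈ ({[PUnit.unit]} : Set (List PUnit.{u + 1})), w <:+: w'} :=
    ⟨by simp, _, rfl, List.infix_rfl⟩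
  let a : Sa.{u} := some ⟨[PUnit.unit], hmem⟩
  let z : Sa.{u} := none
  refine two_mem_of_pair hV h (a := a) (z := z) (Option.some_ne_none _) ?_ ?_ ?_ ?_ ?_ False.elim
    fun _ => ?_
  · rintro (_ | x)
    · exact ⟨rfl, rfl⟩
    · exact ⟨rfl, rfl⟩
  · exact if_neg (Option.some_ne_none _)
  · exact if_neg (Option.some_ne_none _).symm
  · exact if_pos rfl
  · exact if_pos rfl
  · refine dif_neg ?_
    rintro ⟨-, w', rfl, hw⟩
    have := hw.length_le
    simp at this

theorem two_true_mem_M1 {V : Set Alg.{u}} (hV : IsVariety V) (h : M1 ∈ V) :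
    two.{u} True ∈ V := by
  have hmem : ([] : List PUnit.{u + 1}) ∈ {w : List PUnit.{u + 1} |
      ∃ w' ∈ ({[]} : Set (List PUnit.{u + 1})), w <:+: w'} :=
    ⟨_, rfl, List.infix_rfl⟩
  let a : M1.{u} := some ⟨[], hmem⟩
  let z : M1.{u} := none
  refine two_mem_of_pair hV h (a := a) (z := z) (Option.some_ne_none _) ?_ ?_ ?_ ?_ ?_ (fun _ => ?_)
    (fun h => (h trivial).elim)
  · rintro (_ | x)
    · exact ⟨rfl, rfl⟩
    · exact ⟨rfl, rfl⟩
  · exact if_neg (Option.some_ne_none _)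
  · exact if_neg (Option.some_ne_none _).symm
  · exact if_pos rfl
  · exact if_pos rfl
  · exact dif_pos hmem

/-! ### The variety generated by the two-element flat semirings -/

/-- The laws of the variety generated by `S(a)` and `M(1)`: semilattices with a product of the
form `x * y = p (x + y)` where `p (x + y) = p x + y` and `p x = x * x`. -/
structure IsSquareSemilattice (A : Alg.{u}) : Prop where
  add_assoc : ∀ a b c : A, a + b + c = a + (b + c)
  add_comm : ∀ a b : A, a + b = b + a
  add_idem : ∀ a : A, a + a = a
  mul_eq : ∀ a b : A, a * b = (a + b) * (a + b)
  sq_add : ∀ a b : A, (a + b) * (a + b) = a * a + b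

/-- The identities defining `IsSquareSemilattice`. -/
def squareSemilatticeIdentities : Set (Term × Term) :=
  let x := Term.var 0
  let y := Term.var 1
  let z := Term.var 2
  {(.add (.add x y) z, .add x (.add y z)), (.add x y, .add y x), (.add x x, x),
    (.mul x y, .mul (.add x y) (.add x y)), (.mul (.add x y) (.add x y), .add (.mul x x) y)}

theorem mem_models_squareSemilatticeIdentities {A : Alg.{u}} :
    A ∈ models squareSemilatticeIdentities ↔ IsSquareSemilattice A := by
  constructor
  · intro h
    let w : A → A → A → ℕ → A := fun a b c n => if n = 0 then a else if n = 1 then b else c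
    refine ⟨fun a b c => ?_, fun a b => ?_, fun a => ?_, fun a b => ?_, fun a b => ?_⟩
    · exact h (_, _) (Or.inl rfl) (w a b c)
    · exact h (_, _) (Or.inr (Or.inl rfl)) (w a b b)
    · exact h (_, _) (Or.inr (Or.inr (Or.inl rfl))) (w a a a)
    · exact h (_, _) (Or.inr (Or.inr (Or.inr (Or.inl rfl)))) (w a b b)
    · exact h (_, _) (Or.inr (Or.inr (Or.inr (Or.inr rfl)))) (w a b b)
  · rintro h e (rfl | rfl | rfl | rfl | rfl) v
    exacts [h.add_assoc _ _ _, h.add_comm _ _, h.add_idem _, h.mul_eq _ _, h.sq_add _ _]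

theorem finite_squareSemilatticeIdentities : squareSemilatticeIdentities.Finite := by
  unfold squareSemilatticeIdentities
  simp

namespace IsSquareSemilattice

variable {A : Alg.{u}} (h : IsSquareSemilattice A)

include h

theorem add_le_iff (a b c : A) : a + b + c = c ↔ a + c = c ∧ b + c = c := by
  constructor
  · intro e
    constructor
    · calc a + c = a + (a + b + c) := by rw [e]
        _ = a + a + b + c := by rw [h.add_assoc, h.add_assoc, h.add_assoc]
        _ = c := by rw [h.add_idem, e]
    · calc b + c = b + (b + a + c) := by rw [h.add_comm b a, e]
        _ = b + b + a + c := by rw [h.add_assoc, h.add_assoc, h.add_assoc]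
        _ = c := by rw [h.add_idem, h.add_comm b a, e]
  · rintro ⟨e₁, e₂⟩
    rw [h.add_assoc, e₂, e₁]

theorem sq_sq (a : A) : a * a * (a * a) = a * a := by
  have e : a * a + a = a * a := by rw [← h.sq_add, h.add_idem]
  have e' := h.sq_add a (a * a)
  rw [h.add_comm a, e, h.add_idem] at e'
  exact e'

/-- With `p x = x * x` a closure operator, `a * b + c = p (a + b + c)`. This equals `c` exactly when
`c` is closed and lies above `a + b`. -/
theorem mul_le_iff (a b c : A) : a * b + c = c ↔ c * c = c ∧ a + c = c ∧ b + c = c := by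
  rw [h.mul_eq, ← h.sq_add, ← h.add_le_iff]
  constructor
  · intro e
    have hc : c * c = c := by
      rw [← e, h.sq_sq]
    refine ⟨hc, ?_⟩
    have e' : (a + b + c) * (a + b + c) + (a + b + c) = (a + b + c) * (a + b + c) := by
      rw [← h.sq_add, h.add_idem]
    rw [e] at e'
    rw [h.add_comm, h.add_assoc, h.add_idem] at e'
    exact e'
  · rintro ⟨hc, e⟩
    rw [e, hc]

/-- For every `c`, the map sending `a` to the truth value of `a ≤ c` is a homomorphism onto a
two-element flat semiring. -/
theorem isHom_le (c : A) :
    IsHom (A := A) (B := two.{u} (c * c = c)) (fun a => ⟨a + c = c⟩) :=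
  ⟨fun a b => ULift.ext _ _ (propext (h.add_le_iff a b c)),
    fun a b => ULift.ext _ _ (propext (h.mul_le_iff a b c))⟩

/-- A model belongs to every variety containing the two-element flat semirings needed to separate
its elements. -/
theorem mem_of_two_mem {V : Set Alg.{u}} (hV : IsVariety V)
    (htwo : ∀ a c : A, a + c ≠ c → two.{u} (c * c = c) ∈ V) : A ∈ V := by
  -- The coordinate of a greatest element is constant and separates nothing. Leaving it out matters
  -- when all products are equal, since such an element may be idempotent.
  let I : Type u := {c : A // ∃ a : A, a + c ≠ c}
  refine hV.subalgebra A (prod fun i : I => two (i.1 * i.1 = i.1))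
    (fun a i => ⟨a + i.1 = i.1⟩) (hV.product I _ fun i => i.2.elim fun a ha => htwo a i.1 ha)
    ⟨fun a b => funext fun i => (h.isHom_le i.1).1 a b,
      fun a b => funext fun i => (h.isHom_le i.1).2 a b⟩ ?_
  have key : ∀ a b : A, (∀ c : A, (∃ a : A, a + c ≠ c) → (a + c = c ↔ b + c = c)) →
      a + b = b := by
    intro a b hab
    by_contra hne
    exact hne ((hab b ⟨a, hne⟩).2 (h.add_idem b))
  intro a b hab
  have hab' : ∀ c : A, (∃ a : A, a + c ≠ c) → (a + c = c ↔ b + c = c) := fun c hc =>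
    iff_of_eq (congrArg ULift.down (congrFun hab ⟨c, hc⟩))
  rw [← key b a fun c hc => (hab' c hc).symm, h.add_comm, key a b hab']

end IsSquareSemilattice

/-! ### Flat semirings in the variety of the max-plus algebra -/

theorem IsFlatSemiring.isSquareSemilattice {A : Alg.{u}} (hf : IsAISemiring A) {z : A}
    (hz : ∀ a : A, z * a = z ∧ a * z = z) (hadd : ∀ a b : A, a ≠ b → a + b = z)
    (hsq : ∀ a : A, a * a = a ∨ a * a = z) (hmul : ∀ a b : A, a ≠ b → a * b = z) :
    IsSquareSemilattice A where
  add_assoc := hf.add_assoc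
  add_comm := hf.add_comm
  add_idem := hf.add_idem
  mul_eq a b := by
    by_cases h : a = b
    · rw [h, hf.add_idem]
    · rw [hmul a b h, hadd a b h, (hz z).1]
  sq_add a b := by
    by_cases h : a = b
    · subst h
      rw [hf.add_idem]
      rcases hsq a with e | e
      · rw [e, hf.add_idem]
      · rw [e]
        by_cases haz : z = a
        · rw [← haz, hf.add_idem]
        · rw [hadd z a haz]
    · rw [hadd a b h, (hz z).1]
      rcases hsq a with e | e
      · rw [e, hadd a b h]
      · rw [e]
        by_cases hbz : z = b
        · rw [← hbz, hf.add_idem]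
        · rw [hadd z b hbz]

/-- By `x + xy ≈ xy` either `a = ab`, or `ab = a + ab = z` by flatness. If `ab = a` and `ba = b`,
commutativity gives `a = b`. -/
theorem flat_mul_of_mem_variety_maxPlus {A : Alg.{u}} (hA : A ∈ variety {maxPlus.{u}})
    {z : A} (hadd : ∀ a b : A, a ≠ b → a + b = z) :
    (∀ a : A, a * a = a ∨ a * a = z) ∧ ∀ a b : A, a ≠ b → a * b = z := by
  have hcomm : ∀ a b : A, a * b = b * a := by
    have : Satisfies maxPlus.{u} (.mul (.var 0) (.var 1), .mul (.var 1) (.var 0)) := by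
      rw [satisfies_maxPlus_iff]
      intro v
      exact Nat.add_comm _ _
    intro a b
    exact satisfies_of_mem_variety this hA (fun n => if n = 0 then a else b)
  have hle : ∀ a b : A, a + a * b = a * b := by
    have : Satisfies maxPlus.{u}
        (.add (.var 0) (.mul (.var 0) (.var 1)), .mul (.var 0) (.var 1)) := by
      rw [satisfies_maxPlus_iff]
      intro v
      exact max_eq_right (Nat.le_add_right _ _)
    intro a b
    exact satisfies_of_mem_variety this hA (fun n => if n = 0 then a else b)
  have key : ∀ a b : A, a * b = a ∨ a * b = z := by
    intro a b
    by_cases h : a = a * b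
    · exact Or.inl h.symm
    · exact Or.inr ((hle a b).symm.trans (hadd _ _ h))
  refine ⟨fun a => key a a, fun a b hab => ?_⟩
  rcases key a b with h | h
  · rcases key b a with h' | h'
    · exact absurd (h.symm.trans ((hcomm a b).trans h')) hab
    · exact (hcomm a b).trans h'
  · exact h

theorem Satisfies.constant_mul_iff {A : Alg.{u}} :
    Satisfies A (.mul (.var 0) (.var 1), .mul (.var 2) (.var 3)) ↔
      ∀ a b c d : A, a * b = c * d :=
  ⟨fun h a b c d =>
    h (fun n => if n = 0 then a else if n = 1 then b else if n = 2 then c else d),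
    fun h _ => h _ _ _ _⟩

theorem Satisfies.mul_eq_add_iff {A : Alg.{u}} :
    Satisfies A (.mul (.var 0) (.var 1), .add (.var 0) (.var 1)) ↔ ∀ a b : A, a * b = a + b :=
  ⟨fun h a b => h (fun n => if n = 0 then a else b), fun h _ => h _ _⟩

/-- To show that a variety generated by one algebra is finitely based, it suffices to show that it
contains all models of some finite set of identities of the algebra. -/
theorem finitelyBased_of_models_subset {A : Alg.{u}} {E : Set (Term × Term)} (hE : E.Finite)
    (hA : A ∈ models E) (h : models E ⊆ variety {A}) : FinitelyBased (variety {A}) :=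
  ⟨E, hE, (variety_subset (isVariety_models E) (by rintro _ rfl; exact hA)).antisymm h⟩

/-- A flat semiring in which distinct elements have product zero and all squares are either trivial
or zero is finitely based. -/
theorem IsFlatSemiring.finitelyBased {A : Alg.{u}} (hf : IsAISemiring A) {z : A}
    (hz : ∀ a : A, z * a = z ∧ a * z = z) (hadd : ∀ a b : A, a ≠ b → a + b = z)
    (hsq : ∀ a : A, a * a = a ∨ a * a = z) (hmul : ∀ a b : A, a ≠ b → a * b = z) :
    FinitelyBased (variety {A}) := by
  have hA := IsFlatSemiring.isSquareSemilattice hf hz hadd hsq hmul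
  have hAm := mem_models_squareSemilatticeIdentities.2 hA
  have hV := isVariety_variety.{u} {A}
  have hAV : A ∈ variety {A} := subset_variety _ rfl
  have htrue : (∃ a : A, a ≠ z ∧ a * a = a) → ∀ p : Prop, p → two.{u} p ∈ variety {A} :=
    fun ⟨a, ha, haa⟩ p hp => IsFlatSemiring.two_mem hV hAV hf hz hadd ha (fun _ => haa)
      fun h => absurd hp h
  have hfalse : (∃ a : A, a ≠ z ∧ a * a = z) → ∀ p : Prop, ¬ p → two.{u} p ∈ variety {A} :=
    fun ⟨a, ha, haa⟩ p hp => IsFlatSemiring.two_mem hV hAV hf hz hadd ha (fun h => absurd h hp)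
      fun _ => haa
  by_cases h1 : ∃ a : A, a ≠ z ∧ a * a = a
  · by_cases h2 : ∃ a : A, a ≠ z ∧ a * a = z
    · refine finitelyBased_of_models_subset finite_squareSemilatticeIdentities hAm fun B hB => ?_
      refine (mem_models_squareSemilatticeIdentities.1 hB).mem_of_two_mem hV fun a c _ => ?_
      by_cases hc : c * c = c
      exacts [htrue h1 _ hc, hfalse h2 _ hc]
    · push Not at h2
      -- Without nonzero elements of zero square, the extra law `xy ≈ x + y` makes every `c`
      -- idempotent, so only `two True` is needed.
      refine finitelyBased_of_models_subset (finite_squareSemilatticeIdentities.insert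
        (.mul (.var 0) (.var 1), .add (.var 0) (.var 1))) ?_ fun B hB => ?_
      · rintro e (rfl | he)
        · refine Satisfies.mul_eq_add_iff.2 fun a b => ?_
          by_cases hab : a = b
          · subst hab
            rw [hf.add_idem]
            by_cases haz : a = z
            · rw [haz, (hz z).1]
            · exact (hsq a).resolve_right (h2 a haz)
          · rw [hmul a b hab, hadd a b hab]
        · exact hAm e he
      · have hBm := mem_models_squareSemilatticeIdentities.1 fun e he => hB e (Or.inr he)
        have hB' := Satisfies.mul_eq_add_iff.1 (hB _ (Or.inl rfl))
        exact hBm.mem_of_two_mem hV fun a c _ =>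
          htrue h1 _ ((hB' c c).trans (hBm.add_idem c))
  · push Not at h1
    have hnil : ∀ a b : A, a * b = z := by
      intro a b
      by_cases hab : a = b
      · subst hab
        by_cases haz : a = z
        · rw [haz, (hz z).1]
        · exact (hsq a).resolve_left (h1 a haz)
      · exact hmul a b hab
    by_cases h2 : ∃ a : A, a ≠ z ∧ a * a = z
    · refine finitelyBased_of_models_subset (finite_squareSemilatticeIdentities.insert
        (.mul (.var 0) (.var 1), .mul (.var 2) (.var 3))) ?_ fun B hB => ?_
      · rintro e (rfl | he)
        · exact Satisfies.constant_mul_iff.2 fun a b c d => by rw [hnil, hnil]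
        · exact hAm e he
      · have hBm := mem_models_squareSemilatticeIdentities.1 fun e he => hB e (Or.inr he)
        have hB' := Satisfies.constant_mul_iff.1 (hB _ (Or.inl rfl))
        -- All products coincide, so an idempotent `c` is the greatest element and indexes no
        -- coordinate; only `two False` is needed.
        refine hBm.mem_of_two_mem hV fun a c hac => hfalse h2 _ fun hc => hac ?_
        exact ((hBm.mul_le_iff a a c).1 (by rw [hB' a a c c, hc, hBm.add_idem])).2.1
    · have htriv : ∀ a b : A, a = b := by
        have : ∀ a : A, a = z := fun a => by
          by_contra haz
          exact h2 ⟨a, haz, hnil a a⟩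
        exact fun a b => (this a).trans (this b).symm
      refine finitelyBased_of_models_subset (Set.finite_singleton (Term.var 0, Term.var 1)) ?_
        fun B hB => ?_
      · rintro e rfl v
        exact htriv _ _
      · have hB' : ∀ a b : B, a = b := fun a b => hB _ rfl (fun n => if n = 0 then a else b)
        exact hV.hom_image A B (fun _ => Classical.arbitrary B) hAV
          ⟨fun _ _ => hB' _ _, fun _ _ => hB' _ _⟩ fun b => ⟨z, hB' _ _⟩

end AISemiring

theorem mainTheorem6 :
    (∃ V : Set AISemiring.Alg.{u},
      AISemiring.IsLimitVariety V ∧ V ⊆ AISemiring.variety {AISemiring.maxPlus.{u}}) ∧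
    (∀ A : AISemiring.Alg.{u},
      A ∈ AISemiring.variety {AISemiring.maxPlus.{u}} → AISemiring.IsFlatSemiring A →
        AISemiring.FinitelyBased (AISemiring.variety {A}) ∧
        A ∈ AISemiring.variety {AISemiring.Sa.{u}, AISemiring.M1.{u}}) := by
  refine ⟨AISemiring.exists_limitVariety_subset (AISemiring.isVariety_variety _)
    AISemiring.not_finitelyBased_variety_maxPlus, ?_⟩
  rintro A hA ⟨hf, z, hz, hadd⟩
  obtain ⟨hsq, hmul⟩ := AISemiring.flat_mul_of_mem_variety_maxPlus hA hadd
  refine ⟨AISemiring.IsFlatSemiring.finitelyBased hf hz hadd hsq hmul, ?_⟩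
  have hV := AISemiring.isVariety_variety.{u} {AISemiring.Sa.{u}, AISemiring.M1.{u}}
  refine (AISemiring.IsFlatSemiring.isSquareSemilattice hf hz hadd hsq hmul).mem_of_two_mem hV
    fun a c _ => ?_
  by_cases hc : c * c = c
  · rw [eq_true hc]
    exact AISemiring.two_true_mem_M1 hV (AISemiring.subset_variety _ (Or.inr rfl))
  · rw [eq_false hc]
    exact AISemiring.two_false_mem_Sa hV (AISemiring.subset_variety _ (Or.inl rfl))
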